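/- Let $\lambda_1,\lambda_2\in\mathbb{C}\setminus\{0,1\}$ and put $r(u)=(\lambda_1-1)(\lambda_2-1)(u+u^{-1})-2(\lambda_1+1)(\lambda_2+1)$, $p_2=u^2r(u)$, $p_1=16\lambda_1\lambda_2u^4$. Consider the Jacobian elliptic K3 surfaces over $\mathbb{P}^1$ (with affine coordinate $u$) given by the Weierstrass equations $$\mathcal{Y}_{\lambda_1,\lambda_2}:\; Y^2=X^3+p_2X^2+p_1X,\qquad \mathcal{S}'_{\lambda_1,\lambda_2}:\; y^2=x^3-\tfrac12p_2\,x^2+p_1'\,x,\quad p_1'=\tfrac1{16}\left(p_2^2-4p_1\right)=\tfrac1{16}u^4\left(r(u)^2-64\lambda_1\lambda_2\right).$$ For $n=1,2$ let $\mathcal{E}'_n: Y_n^2=X_n^3+\tfrac{1+\lambda_n}{2}X_n^2+\tfrac{(1-\lambda_n)^2}{16}X_n$ be the quotient of $\mathcal{E}_n: y_n^2=x_n(x_n-1)(x_n-\lambda_n)$ by its two-torsion point $(0,0)$. Then $\mathcal{S}'_{\lambda_1,\lambda_2}$ is the Kummer surface $\operatorname{Kum}(\mathcal{E}'_1\times\mathcal{E}'_2)$,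 and the following holds. The surfaces $\mathcal{Y}_{\lambda_1,\lambda_2}$ and $\mathcal{S}'_{\lambda_1,\lambda_2}$ admit Van Geemen–Sarti involutions $k$ and $k'$, namely the fiberwise translations by the sections of order two $T:(X,Y)=(0,0)$ and $T':(x,y)=(0,0)$: $$k:(X,Y)\mapsto\left(\frac{p_1}{X},-\frac{p_1Y}{X^2}\right),\qquad k':(x,y)\mapsto\left(\frac{p_1'}{x},-\frac{p_1'y}{x^2}\right),$$ which leave the two-forms below invariant. The involutions are dual: the rational maps $$\varphi:\mathcal{Y}_{\lambda_1,\lambda_2}\dashrightarrow\mathcal{S}'_{\lambda_1,\lambda_2},\;(X,Y)\mapsto\left(\frac{Y^2}{4X^2},\frac{Y(X^2-p_1)}{8X^2}\right),\qquad \varphi':\mathcal{S}'_{\lambda_1,\lambda_2}\dashrightarrow\mathcal{Y}_{\lambda_1,\lambda_2},\;(x,y)\mapsto\left(\frac{y^2}{x^2},\frac{y\,(16x^2-p_2^2+4p_1)}{16x^2}\right)$$ over the identity of $\mathbb{P}^1$ are dual fiberwise two-isogenies, on the generic fiber and on every smooth fiber, with kernels $\{O,T\}$ and $\{O,T'\}$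 and with $\varphi'\circ\varphi=[2]$, $\varphi\circ\varphi'=[2]$. They are the quotient maps by $k$ and $k'$ (up to birational equivalence). For the two-forms $\omega_{\mathcal{Y}}=du\wedge\frac{dX}{Y}$ and $\omega_{\mathcal{S}'}=\tfrac12\,du\wedge\frac{dx}{y}$ one has $$\varphi^*\omega_{\mathcal{S}'}=\omega_{\mathcal{Y}},\qquad (\varphi')^*\omega_{\mathcal{Y}}=2\,\omega_{\mathcal{S}'}$$ (equivalently, $\varphi^*(du\wedge dx/y)=2\,\omega_{\mathcal{Y}}$ and $(\varphi')^*\omega_{\mathcal{Y}}=du\wedge dx/y$). -/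

import Mathlib

open Polynomial

namespace KummerSandwich

universe v

/-! ### Rational two-forms and their pull-back -/

section TwoForms

variable {K L : Type*} [Field K] [Field L] [Algebra ℂ K] [Algebra ℂ L]

/-- Rational two-forms on (any smooth model of) the complex variety with function field `K`:
the second exterior power over `K` of the Kähler differentials of `K` over `ℂ`. -/
abbrev TwoForms (K : Type*) [Field K] [Algebra ℂ K] : Type _ := ⋀[K]^2 Ω[K⁄ℂ]

/-- The two-form `df ∧ dg`. -/
noncomputable def wedgeD (f g : K) : TwoForms K :=
  exteriorPower.ιMulti K 2 ![KaehlerDifferential.D ℂ K f, KaehlerDifferential.D ℂ K g]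

/-- The pull-back of rational two-forms along the dominant rational map whose action on rational
functions is `φ : K → L`: it sends `a • (df ∧ dg)` to `φ a • (d(φ f) ∧ d(φ g))`
(see `pullback_smul_wedgeD`). -/
noncomputable def pullback (φ : K →ₐ[ℂ] L) : TwoForms K → TwoForms L :=
  letI := φ.toRingHom.toAlgebra
  haveI : IsScalarTower ℂ K L := .of_algebraMap_eq' φ.comp_algebraMap.symm
  let dφ : Ω[K⁄ℂ] →ₗ[K] Ω[L⁄ℂ] := KaehlerDifferential.map ℂ ℂ K L
  let m : Ω[K⁄ℂ] [⋀^Fin 2]→ₗ[K] TwoForms L :=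
    { ((exteriorPower.ιMulti L 2 (M := Ω[L⁄ℂ])).toMultilinearMap.restrictScalars K).compLinearMap
        (fun _ => dφ) with
      map_eq_zero_of_eq' := fun v _ _ h hij =>
        (exteriorPower.ιMulti L 2 (M := Ω[L⁄ℂ])).map_eq_zero_of_eq (fun n => dφ (v n))
          (congrArg dφ h) hij }
  exteriorPower.alternatingMapLinearEquiv m

theorem pullback_add (φ : K →ₐ[ℂ] L) (ω η : TwoForms K) :
    pullback φ (ω + η) = pullback φ ω + pullback φ η := by
  unfold pullback
  exact map_add _ _ _

theorem pullback_smul_wedgeD (φ : K →ₐ[ℂ] L) (a f g : K) :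
    pullback φ (a • wedgeD f g) = φ a • wedgeD (φ f) (φ g) := by
  let := φ.toRingHom.toAlgebra
  have : IsScalarTower ℂ K L := .of_algebraMap_eq' φ.comp_algebraMap.symm
  have h : ∀ v, KaehlerDifferential.map ℂ ℂ K L (KaehlerDifferential.D ℂ K v) =
      KaehlerDifferential.D ℂ L (φ v) := fun v => KaehlerDifferential.map_D ℂ ℂ K L v
  unfold pullback wedgeD
  rw [map_smul, exteriorPower.alternatingMapLinearEquiv_apply_ιMulti, ← algebraMap_smul L]
  congr 1
  refine congrArg (exteriorPower.ιMulti L 2) ?_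
  funext i
  fin_cases i
  · exact h f
  · exact h g

end TwoForms

/-! ### The generic point of a Weierstrass curve, translations and isogenies -/

section Curves

open scoped Classical in
/-- The points of `W` over an extension field `L` of the base field `F`. -/
abbrev PointsOver {F : Type*} [Field F] (W : WeierstrassCurve.Affine F)
    (L : Type*) [Field L] [Algebra F L] : Type _ :=
  (WeierstrassCurve.Affine.baseChange W L).Point

variable {F : Type v} [Field F]

/-- The coordinate function `x` in the function field of `W`. -/
noncomputable def xGen (W : WeierstrassCurve.Affine F) : W.FunctionField :=
  algebraMap W.CoordinateRing W.FunctionField (WeierstrassCurve.Affine.CoordinateRing.mk W (C X))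

/-- The coordinate function `y` in the function field of `W`. -/
noncomputable def yGen (W : WeierstrassCurve.Affine F) : W.FunctionField :=
  algebraMap W.CoordinateRing W.FunctionField (WeierstrassCurve.Affine.CoordinateRing.mk W X)

theorem generic_nonsingular [CharZero F] (W : WeierstrassCurve.Affine F) :
    (WeierstrassCurve.Affine.baseChange W W.FunctionField).Nonsingular (xGen W) (yGen W) := by
  have e₁ : (WeierstrassCurve.Affine.baseChange W W.FunctionField).a₁ = algebraMap W.CoordinateRing
      W.FunctionField (WeierstrassCurve.Affine.CoordinateRing.mk W (C (C W.a₁))) := rfl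
  have e₂ : (WeierstrassCurve.Affine.baseChange W W.FunctionField).a₂ = algebraMap W.CoordinateRing
      W.FunctionField (WeierstrassCurve.Affine.CoordinateRing.mk W (C (C W.a₂))) := rfl
  have e₃ : (WeierstrassCurve.Affine.baseChange W W.FunctionField).a₃ = algebraMap W.CoordinateRing
      W.FunctionField (WeierstrassCurve.Affine.CoordinateRing.mk W (C (C W.a₃))) := rfl
  have e₄ : (WeierstrassCurve.Affine.baseChange W W.FunctionField).a₄ = algebraMap W.CoordinateRing
      W.FunctionField (WeierstrassCurve.Affine.CoordinateRing.mk W (C (C W.a₄))) := rfl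
  have e₆ : (WeierstrassCurve.Affine.baseChange W W.FunctionField).a₆ = algebraMap W.CoordinateRing
      W.FunctionField (WeierstrassCurve.Affine.CoordinateRing.mk W (C (C W.a₆))) := rfl
  rw [WeierstrassCurve.Affine.nonsingular_iff]
  constructor
  · rw [WeierstrassCurve.Affine.equation_iff, e₁, e₂, e₃, e₄, e₆, xGen, yGen]
    have h0 : WeierstrassCurve.Affine.CoordinateRing.mk W
        (X ^ 2 + C (C W.a₁ * X + C W.a₃) * X -
          C (X ^ 3 + C W.a₂ * X ^ 2 + C W.a₄ * X + C W.a₆)) = 0 := AdjoinRoot.mk_self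
    have h1 := congrArg (algebraMap W.CoordinateRing W.FunctionField) h0
    simp only [map_add, map_sub, map_mul, map_pow, map_zero] at h1
    linear_combination h1
  · right
    intro h'
    have h : yGen W = -yGen W - (WeierstrassCurve.Affine.baseChange W W.FunctionField).a₁ * xGen W -
      (WeierstrassCurve.Affine.baseChange W W.FunctionField).a₃ := h'
    rw [e₁, e₃, xGen, yGen] at h
    have h2 : algebraMap W.CoordinateRing W.FunctionField
        ((C W.a₁ * X + C W.a₃ : F[X]) • (1 : W.CoordinateRing) +
          (C 2 : F[X]) • WeierstrassCurve.Affine.CoordinateRing.mk W X) = 0 := by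
      rw [WeierstrassCurve.Affine.CoordinateRing.smul, WeierstrassCurve.Affine.CoordinateRing.smul]
      simp only [map_add, map_mul, mul_one, map_ofNat]
      linear_combination h
    have h3 := (map_eq_zero_iff _ (IsFractionRing.injective W.CoordinateRing W.FunctionField)).1 h2
    have h4 := (WeierstrassCurve.Affine.CoordinateRing.smul_basis_eq_zero h3).2
    rw [C_eq_zero] at h4
    exact two_ne_zero h4

/-- The generic point `(x, y)` of `W`, a point of `W` over the function field of `W`. -/
noncomputable def genericPoint [CharZero F] (W : WeierstrassCurve.Affine F) :
    PointsOver W W.FunctionField :=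
  .some (xGen W) (yGen W) (generic_nonsingular W)

open scoped Classical in
/-- The homomorphism `W(L) → W(M)` induced by an embedding `L → M` over `F`. -/
noncomputable def mapPoint (W : WeierstrassCurve.Affine F) {L M : Type*} [Field L] [Field M]
    [Algebra F L] [Algebra F M] (f : L →ₐ[F] M) : PointsOver W L →+ PointsOver W M :=
  WeierstrassCurve.Affine.Point.map f

open scoped Classical in
/-- The automorphism `k` of the function field of `W` is (the action on rational functions of) the
translation by the rational point `T`: it sends the generic point `P` to `P + T`. -/
def IsTranslationBy [CharZero F] (W : WeierstrassCurve.Affine F) (T : PointsOver W F)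
    (k : W.FunctionField ≃ₐ[F] W.FunctionField) : Prop :=
  mapPoint W (k : W.FunctionField →ₐ[F] W.FunctionField) (genericPoint W) =
    genericPoint W + mapPoint W (Algebra.ofId F W.FunctionField) T

open scoped Classical in
/-- `φ`, the action on rational functions of a dominant rational map `W ⇢ W'`, is a two-isogeny
with kernel `{O, T}`: a homomorphism of the groups of points over all extension fields, natural in
the field and given by `φ` at the generic point, of degree two, with kernel `{O, T}`. -/
def IsTwoIsogeny [CharZero F] (W W' : WeierstrassCurve.Affine F) (T : PointsOver W F)
    (φ : W'.FunctionField →ₐ[F] W.FunctionField) : Prop :=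
  (∃ Φ : ∀ (L : Type v) [Field L] [Algebra F L], PointsOver W L →+ PointsOver W' L,
    (∀ (L M : Type v) [Field L] [Algebra F L] [Field M] [Algebra F M] (f : L →ₐ[F] M)
      (P : PointsOver W L), Φ M (mapPoint W f P) = mapPoint W' f (Φ L P)) ∧
    Φ W.FunctionField (genericPoint W) = mapPoint W' φ (genericPoint W') ∧
    ∀ (L : Type v) [Field L] [Algebra F L] (P : PointsOver W L),
      Φ L P = 0 ↔ P = 0 ∨ P = mapPoint W (Algebra.ofId F L) T) ∧
  Module.finrank φ.fieldRange W.FunctionField = 2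

open scoped Classical in
/-- The rational maps `φ : W ⇢ W'` and `φ' : W' ⇢ W` are dual two-isogenies: both
composites are multiplication by two, evaluated at the generic points. -/
def AreDual [CharZero F] (W W' : WeierstrassCurve.Affine F)
    (φ : W'.FunctionField →ₐ[F] W.FunctionField)
    (φ' : W.FunctionField →ₐ[F] W'.FunctionField) : Prop :=
  mapPoint W (φ.comp φ') (genericPoint W) = 2 • genericPoint W ∧
  mapPoint W' (φ'.comp φ) (genericPoint W') = 2 • genericPoint W'

end Curves

/-! ### Jacobian elliptic surfaces over the projective line -/

section Surfaces

/-- The generic fibre, over `ℂ(u)`, of the elliptic surface with a Weierstrass equation over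
`ℂ[u]`. Its rational points form the Mordell-Weil group of the surface. -/
noncomputable abbrev genericFibre (W : WeierstrassCurve ℂ[X]) :
    WeierstrassCurve.Affine (RatFunc ℂ) :=
  (W.map (algebraMap ℂ[X] (RatFunc ℂ))).toAffine

/-- The fibre over the point `u₀` of the affine line. -/
noncomputable abbrev fibre (W : WeierstrassCurve ℂ[X]) (u₀ : ℂ) : WeierstrassCurve.Affine ℂ :=
  (W.map (evalRingHom u₀)).toAffine

/-- The function field of the elliptic surface. -/
abbrev FunField (W : WeierstrassCurve ℂ[X]) : Type := (genericFibre W).FunctionField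

/-- A polynomial in `u` as a rational function on the surface. -/
noncomputable def ofPoly (W : WeierstrassCurve ℂ[X]) (p : ℂ[X]) : FunField W :=
  algebraMap (RatFunc ℂ) (FunField W) (algebraMap ℂ[X] (RatFunc ℂ) p)

/-- The rational two-form `du ∧ dx / y`. -/
noncomputable def twoForm (W : WeierstrassCurve ℂ[X]) : TwoForms (FunField W) :=
  (yGen (genericFibre W))⁻¹ •
    wedgeD (ofPoly W X) (xGen (genericFibre W))

/-- The Weierstrass equation is that of a Jacobian elliptic K3 surface: `aᵢ` is a section of
`𝒪(2i)` on the projective line, the discriminant does not vanish identically, and the equation is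
minimal at every finite point and at `u = ∞` (so that the minimal resolution of the Weierstrass
surface is the smooth minimal elliptic surface, with trivial canonical bundle and Euler
number 24). -/
structure IsEllipticK3 (W : WeierstrassCurve ℂ[X]) : Prop where
  deg_a₁ : W.a₁.natDegree ≤ 2
  deg_a₂ : W.a₂.natDegree ≤ 4
  deg_a₃ : W.a₃.natDegree ≤ 6
  deg_a₄ : W.a₄.natDegree ≤ 8
  deg_a₆ : W.a₆.natDegree ≤ 12
  disc_ne_zero : W.Δ ≠ 0
  minimal : ∀ u₀ : ℂ, ¬ ((X - C u₀) ^ 4 ∣ W.c₄ ∧ (X - C u₀) ^ 6 ∣ W.c₆)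
  minimal_infty : ¬ (W.c₄.natDegree ≤ 4 ∧ W.c₆.natDegree ≤ 6)

open scoped Classical in
/-- `k` is the Van Geemen–Sarti involution of the Jacobian elliptic K3 surface `W` attached to the
section `T`. A K3 surface being the only smooth minimal model of its function field, its
automorphisms are the `ℂ`-automorphisms of that field; those that preserve every fibre are the
`ℂ(u)`-automorphisms. The section `T` has order two in the Mordell-Weil group, `k` is the fibrewise
translation by `T`, an involution, and it preserves the two-form (a Nikulin involution). -/
structure IsVanGeemenSarti (W : WeierstrassCurve ℂ[X]) (T : PointsOver (genericFibre W) (RatFunc ℂ))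
    (k : FunField W ≃ₐ[RatFunc ℂ] FunField W) : Prop where
  isEllipticK3 : IsEllipticK3 W
  order_two : addOrderOf T = 2
  translation : IsTranslationBy (genericFibre W) T k
  involution : orderOf k = 2
  symplectic : pullback ((k : FunField W →ₐ[RatFunc ℂ] FunField W).restrictScalars ℂ) (twoForm W) =
    twoForm W

open scoped Classical in
/-- Complex elliptic curves `E : Y² = X³ + p₂ X² + p₁ X` and `E' : y² = x³ + p₂' x² + p₁' x` are
related by dual two-isogenies `f` and `f'` with kernels `{O, (0,0)}`, given by the stated formulas,
and translation by `(0,0)` is `(X, Y) ↦ (p₁ / X, -p₁ Y / X²)` on either curve. -/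
def HaveDualTwoIsogenies (E E' : WeierstrassCurve.Affine ℂ) : Prop :=
  ∃ (hT : E.Nonsingular 0 0) (hT' : E'.Nonsingular 0 0) (f : E.Point →+ E'.Point)
    (f' : E'.Point →+ E.Point),
    (∀ (x y : ℂ) (h : E.Nonsingular x y), x ≠ 0 →
      ∃ h₁, WeierstrassCurve.Affine.Point.some x y h + .some 0 0 hT =
        .some (E.a₄ / x) (-(E.a₄ * y) / x ^ 2) h₁) ∧
    (∀ (x y : ℂ) (h : E'.Nonsingular x y), x ≠ 0 →
      ∃ h₁, WeierstrassCurve.Affine.Point.some x y h + .some 0 0 hT' =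
        .some (E'.a₄ / x) (-(E'.a₄ * y) / x ^ 2) h₁) ∧
    (∀ (x y : ℂ) (h : E.Nonsingular x y), x ≠ 0 →
      ∃ h₁, f (.some x y h) =
        .some (y ^ 2 / (4 * x ^ 2)) (y * (x ^ 2 - E.a₄) / (8 * x ^ 2)) h₁) ∧
    (∀ (x y : ℂ) (h : E'.Nonsingular x y), x ≠ 0 →
      ∃ h₁, f' (.some x y h) =
        .some (y ^ 2 / x ^ 2) (y * (16 * x ^ 2 - E.a₂ ^ 2 + 4 * E.a₄) / (16 * x ^ 2)) h₁) ∧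
    Function.Surjective f ∧ Function.Surjective f' ∧
    (∀ P, f P = 0 ↔ P = 0 ∨ P = .some 0 0 hT) ∧
    (∀ P, f' P = 0 ↔ P = 0 ∨ P = .some 0 0 hT') ∧
    (∀ P, f' (f P) = 2 • P) ∧ (∀ P, f (f' P) = 2 • P)

/-- The polynomial `u ((l₁ - 1)(l₂ - 1)(u + u⁻¹) - 2 (l₁ + 1)(l₂ + 1))`. -/
noncomputable def q (l₁ l₂ : ℂ) : ℂ[X] :=
  C ((l₁ - 1) * (l₂ - 1)) * (X ^ 2 + 1) - C (2 * (l₁ + 1) * (l₂ + 1)) * X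

/-- The Jacobian elliptic surface `𝒴`:
`Y² = X³ + u² ((l₁ - 1)(l₂ - 1)(u + u⁻¹) - 2 (l₁ + 1)(l₂ + 1)) X² + 16 l₁ l₂ u⁴ X`. -/
noncomputable def surfaceY (l₁ l₂ : ℂ) : WeierstrassCurve ℂ[X] where
  a₁ := 0
  a₂ := X * q l₁ l₂
  a₃ := 0
  a₄ := C (16 * l₁ * l₂) * X ^ 4
  a₆ := 0

/-- The Jacobian elliptic surface `𝒮'`: with `r = (l₁ - 1)(l₂ - 1)(u + u⁻¹) - 2 (l₁ + 1)(l₂ + 1)`,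
`y² = x³ - (1/2) u² r x² + (1/16) u⁴ (r² - 64 l₁ l₂) x`; here `u r = q l₁ l₂`. -/
noncomputable def surfaceS' (l₁ l₂ : ℂ) : WeierstrassCurve ℂ[X] where
  a₁ := 0
  a₂ := -C (1 / 2) * X * q l₁ l₂
  a₃ := 0
  a₄ := C (1 / 16) * X ^ 2 * (q l₁ l₂ ^ 2 - C (64 * l₁ * l₂) * X ^ 2)
  a₆ := 0

/-- The two-form `du ∧ dX / Y` on `𝒴`. -/
noncomputable def omegaY (l₁ l₂ : ℂ) : TwoForms (FunField (surfaceY l₁ l₂)) :=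
  twoForm (surfaceY l₁ l₂)

/-- The two-form `du ∧ dx / (2 y)` on `𝒮'`. -/
noncomputable def omegaS' (l₁ l₂ : ℂ) : TwoForms (FunField (surfaceS' l₁ l₂)) :=
  (2 : FunField (surfaceS' l₁ l₂))⁻¹ • twoForm (surfaceS' l₁ l₂)

end Surfaces

/-! ### Kummer surfaces of products of elliptic curves -/

section Kummer

/-- The Legendre curve `ℰ : y² = x (x - 1) (x - l)`. -/
def legendre (l : ℂ) : WeierstrassCurve.Affine ℂ where
  a₁ := 0
  a₂ := -(1 + l)
  a₃ := 0
  a₄ := l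
  a₆ := 0

/-- The curve `ℰ' : Y² = X³ + (1 + l)/2 X² + (1 - l)²/16 X`, the quotient of the Legendre curve by
its point `(0,0)`. -/
noncomputable def legendreQuotient (l : ℂ) : WeierstrassCurve.Affine ℂ where
  a₁ := 0
  a₂ := (1 + l) / 2
  a₃ := 0
  a₄ := (1 - l) ^ 2 / 16
  a₆ := 0

/-- The function field of `E₁ × E₂`: the function field of `E₂` over that of `E₁`. -/
abbrev ProductField (E₁ E₂ : WeierstrassCurve.Affine ℂ) : Type :=
  (WeierstrassCurve.Affine.baseChange E₂ E₁.FunctionField).FunctionField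

/-- `ι` is the action on rational functions of the inversion `(P₁, P₂) ↦ (-P₁, -P₂)` of
`E₁ × E₂`. -/
structure IsInversion (E₁ E₂ : WeierstrassCurve.Affine ℂ)
    (ι : ProductField E₁ E₂ ≃ₐ[ℂ] ProductField E₁ E₂) : Prop where
  x₁ : ι (algebraMap E₁.FunctionField _ (xGen E₁)) = algebraMap E₁.FunctionField _ (xGen E₁)
  y₁ : ι (algebraMap E₁.FunctionField _ (yGen E₁)) = algebraMap E₁.FunctionField _
    ((WeierstrassCurve.Affine.baseChange E₁ E₁.FunctionField).negY (xGen E₁) (yGen E₁))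
  x₂ : ι (xGen (WeierstrassCurve.Affine.baseChange E₂ E₁.FunctionField)) =
    xGen (WeierstrassCurve.Affine.baseChange E₂ E₁.FunctionField)
  y₂ : ι (yGen (WeierstrassCurve.Affine.baseChange E₂ E₁.FunctionField)) =
    (WeierstrassCurve.Affine.baseChange E₂ (ProductField E₁ E₂)).negY
      (xGen (WeierstrassCurve.Affine.baseChange E₂ E₁.FunctionField))
      (yGen (WeierstrassCurve.Affine.baseChange E₂ E₁.FunctionField))

/-- `K` is the function field of the Kummer surface `Kum(E₁ × E₂)` of two elliptic curves: the
field of those rational functions on `E₁ × E₂` that are invariant under the inversion. (A K3 surface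
with function field `K` is then isomorphic to `Kum(E₁ × E₂)`.) -/
def IsKummerField (K : Type*) [Field K] [Algebra ℂ K] (E₁ E₂ : WeierstrassCurve.Affine ℂ) : Prop :=
  E₁.Δ ≠ 0 ∧ E₂.Δ ≠ 0 ∧ ∃ ι : ProductField E₁ E₂ ≃ₐ[ℂ] ProductField E₁ E₂, IsInversion E₁ E₂ ι ∧
    Nonempty (K ≃ₐ[ℂ] AlgHom.equalizer (ι : ProductField E₁ E₂ →ₐ[ℂ] ProductField E₁ E₂)
      (AlgHom.id ℂ _))

end Kummer

end KummerSandwich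

/-! On `y² = x³ + a x² + b x` put `s = y / x`, so that `s² = x + a + b / x`. Translation by `T = (0,
0)` sends `x` to `b / x` and `s` to `-s`, hence fixes `ξ = s²` and `η = s (x - b / x)`. These
satisfy `η² = ξ³ - 2 a ξ² + (a² - 4 b) ξ`, and the twist `(c² ξ, c³ η)` is the isogeny attached to
an `IsogenyPair`. The isogenies of the theorem are all of this kind: `c = 1/2` from `𝒴` to `𝒮'`, `c
= 1` back, and `2 c c' = 1` makes the composites equal to `[2]` (`hom_hom`).

Additivity (`toFun_add`) is checked by chords and tangents: three points on a line `y = ℓ x + m`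
have images on a line of slope `c (ℓ - b / m)`, and the positions relative to `T` where this breaks
down are handled separately. The argument needs only `2 ≠ 0`, so it serves the generic fibre, its
base changes and the smooth special fibres alike.

On function fields, a solution of the equation with transcendental abscissa is an embedding, so the
isogeny and the translation become field maps by evaluation at the generic point. The element `s`
generates the function field over the image of `φ`, its square lies in that image, and the
translation negates it. Hence the degree is two and the image is the fixed field
(`translation_fixed_iff`).

For the two-forms, `a` and `b` depend on `u` alone and `du ∧ du = 0`, so they behave as constants:
`dξ` becomes `(1 - b / x²) dx`, and division by `c³ η` leaves the factor `c⁻¹` (`pullback_isogeny`).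

For the Kummer surface, let `sₙ² = λₙ`. The cubic of `ℰ'ₙ` splits as `x (x + αₙ) (x + βₙ)` with `αₙ
= (1 - sₙ)² / 4`, `βₙ = (1 + sₙ)² / 4`. With `t = x₁ / x₂`, a constant multiple of `u`, and `w = y₁
y₂`, one has `(w / x₂)² = t (t x₂ + α₁) (t x₂ + β₁) (x₂ + α₂) (x₂ + β₂)`, a quartic in `x₂` with
known roots. The Möbius map taking `-α₂` to `∞` and `-β₂` to `0` turns it into the cubic of `𝒮'`
(`kummer_equation`). Conversely `u, x, y` determine `x₁, x₂, w` (`mem_of_kummer_mem`), which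
generate the invariants of the inversion. -/

namespace KummerSandwich

universe v

/-! ### Two-isogenies of Weierstrass curves with a marked two-torsion point -/

section PointFormulas

open WeierstrassCurve.Affine

/-- The curves `W : y² = x³ + a x² + b x` and `W' : y² = x³ - 2 c² a x² + c⁴ (a² - 4 b) x` are
smooth, the second being (a twist by `c` of) the quotient of the first by `(0, 0)`. -/
structure IsogenyPair {K : Type*} [Field K] (c : K) (W W' : WeierstrassCurve.Affine K) : Prop where
  a₁ : W.a₁ = 0
  a₃ : W.a₃ = 0
  a₆ : W.a₆ = 0
  a₁' : W'.a₁ = 0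
  a₃' : W'.a₃ = 0
  a₆' : W'.a₆ = 0
  a₂' : W'.a₂ = -2 * c ^ 2 * W.a₂
  a₄' : W'.a₄ = c ^ 4 * (W.a₂ ^ 2 - 4 * W.a₄)
  a₄_ne : W.a₄ ≠ 0
  a₄'_ne : W'.a₄ ≠ 0
  two_ne : (2 : K) ≠ 0

namespace IsogenyPair

variable {K : Type*} [Field K] {c : K} {W W' : WeierstrassCurve.Affine K}

theorem c_ne (h : IsogenyPair c W W') : c ≠ 0 := by
  rintro rfl
  exact h.a₄'_ne (by rw [h.a₄']; ring)

theorem disc_ne (h : IsogenyPair c W W') : W.a₂ ^ 2 - 4 * W.a₄ ≠ 0 := fun h0 =>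
  h.a₄'_ne (by rw [h.a₄', h0, mul_zero])

theorem equation_iff (h : IsogenyPair c W W') (x y : K) :
    W.Equation x y ↔ y ^ 2 = x ^ 3 + W.a₂ * x ^ 2 + W.a₄ * x := by
  rw [WeierstrassCurve.Affine.equation_iff, h.a₁, h.a₃, h.a₆]
  simp

theorem equation_iff' (h : IsogenyPair c W W') (x y : K) :
    W'.Equation x y ↔ y ^ 2 = x ^ 3 + W'.a₂ * x ^ 2 + W'.a₄ * x := by
  rw [WeierstrassCurve.Affine.equation_iff, h.a₁', h.a₃', h.a₆']
  simp

theorem Δ_eq (h : IsogenyPair c W W') : W.Δ = 2 ^ 4 * W.a₄ ^ 2 * (W.a₂ ^ 2 - 4 * W.a₄) := by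
  simp only [WeierstrassCurve.Δ, WeierstrassCurve.b₂, WeierstrassCurve.b₄, WeierstrassCurve.b₆,
    WeierstrassCurve.b₈, h.a₁, h.a₃, h.a₆]
  ring

theorem Δ_eq' (h : IsogenyPair c W W') : W'.Δ = 2 ^ 8 * c ^ 4 * W'.a₄ ^ 2 * W.a₄ := by
  simp only [WeierstrassCurve.Δ, WeierstrassCurve.b₂, WeierstrassCurve.b₄, WeierstrassCurve.b₆,
    WeierstrassCurve.b₈, h.a₁', h.a₃', h.a₆', h.a₂']
  linear_combination (-64 * W'.a₄ ^ 2) * h.a₄'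

theorem Δ_ne (h : IsogenyPair c W W') : W.Δ ≠ 0 := by
  rw [h.Δ_eq]
  exact mul_ne_zero (mul_ne_zero (pow_ne_zero _ h.two_ne) (pow_ne_zero _ h.a₄_ne)) h.disc_ne

theorem Δ_ne' (h : IsogenyPair c W W') : W'.Δ ≠ 0 := by
  rw [h.Δ_eq']
  exact mul_ne_zero (mul_ne_zero (mul_ne_zero (pow_ne_zero _ h.two_ne) (pow_ne_zero _ h.c_ne))
    (pow_ne_zero _ h.a₄'_ne)) h.a₄_ne

theorem nonsingular_iff (h : IsogenyPair c W W') (x y : K) :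
    W.Nonsingular x y ↔ y ^ 2 = x ^ 3 + W.a₂ * x ^ 2 + W.a₄ * x := by
  rw [← equation_iff_nonsingular_of_Δ_ne_zero h.Δ_ne, h.equation_iff]

theorem nonsingular_iff' (h : IsogenyPair c W W') (x y : K) :
    W'.Nonsingular x y ↔ y ^ 2 = x ^ 3 + W'.a₂ * x ^ 2 + W'.a₄ * x := by
  rw [← equation_iff_nonsingular_of_Δ_ne_zero h.Δ_ne', h.equation_iff']

theorem map {L : Type*} [Field L] (h : IsogenyPair c W W') (f : K →+* L) :
    IsogenyPair (f c) (WeierstrassCurve.map W f) (WeierstrassCurve.map W' f) where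
  a₁ := by simp [h.a₁]
  a₃ := by simp [h.a₃]
  a₆ := by simp [h.a₆]
  a₁' := by simp [h.a₁']
  a₃' := by simp [h.a₃']
  a₆' := by simp [h.a₆']
  a₂' := by simp [h.a₂', map_ofNat]
  a₄' := by simp [h.a₄', map_ofNat]
  a₄_ne := by simpa using h.a₄_ne
  a₄'_ne := by simpa using h.a₄'_ne
  two_ne := by simpa only [map_ofNat] using (map_ne_zero f).2 h.two_ne

theorem nonsingular_zero (h : IsogenyPair c W W') : W.Nonsingular 0 0 := by
  rw [h.nonsingular_iff]; ring

theorem negY_eq (h : IsogenyPair c W W') (x y : K) : W.negY x y = -y := by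
  rw [negY, h.a₁, h.a₃]; ring

theorem negY_eq' (h : IsogenyPair c W W') (x y : K) : W'.negY x y = -y := by
  rw [negY, h.a₁', h.a₃']; ring

theorem neg_some (h : IsogenyPair c W W') {x y : K} (hxy : W.Nonsingular x y) :
    -Point.some x y hxy = Point.some x (-y) (by rwa [← h.negY_eq x y, nonsingular_neg]) := by
  rw [Point.neg_some]
  simp only [h.negY_eq]

/-- With `ξ = y² / x² = x + a + b / x` one has `(x - b / x)² = (ξ - a)² - 4 b`; multiplying by `ξ`
gives the equation of the quotient curve. -/
theorem map_nonsingular (h : IsogenyPair c W W') {x y : K} (hx : x ≠ 0)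
    (hxy : W.Nonsingular x y) :
    W'.Nonsingular (c ^ 2 * (y ^ 2 / x ^ 2)) (c ^ 3 * (y * (x ^ 2 - W.a₄) / x ^ 2)) := by
  rw [h.nonsingular_iff', h.a₂', h.a₄']
  rw [h.nonsingular_iff] at hxy
  have hb : W.a₄ = y ^ 2 / x - x ^ 2 - W.a₂ * x := by
    field_simp
    linear_combination -hxy
  rw [hb]
  field_simp
  ring

open scoped Classical in
/-- The two-isogeny with kernel `{O, (0,0)}`, as a map of points. -/
noncomputable def toFun (h : IsogenyPair c W W') : W.Point → W'.Point
  | .zero => .zero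
  | .some x _ hxy => if hx : x = 0 then .zero else .some _ _ (h.map_nonsingular hx hxy)

theorem toFun_zero (h : IsogenyPair c W W') : h.toFun 0 = 0 := rfl

theorem toFun_some (h : IsogenyPair c W W') {x y : K} (hxy : W.Nonsingular x y) (hx : x ≠ 0) :
    h.toFun (.some x y hxy) = .some _ _ (h.map_nonsingular hx hxy) := dif_neg hx

theorem toFun_some_zero (h : IsogenyPair c W W') {y : K} (hxy : W.Nonsingular 0 y) :
    h.toFun (.some 0 y hxy) = 0 := dif_pos rfl

theorem y_eq_zero (h : IsogenyPair c W W') {y : K} (hxy : W.Nonsingular 0 y) : y = 0 := by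
  rw [h.nonsingular_iff] at hxy
  exact pow_eq_zero_iff two_ne_zero |>.1 (by rw [hxy]; ring)

theorem toFun_eq_zero_iff (h : IsogenyPair c W W') (P : W.Point) :
    h.toFun P = 0 ↔ P = 0 ∨ P = .some 0 0 h.nonsingular_zero := by
  rcases P with _ | ⟨x, y, hxy⟩
  · exact ⟨fun _ => .inl rfl, fun _ => rfl⟩
  · by_cases hx : x = 0
    · subst hx
      obtain rfl := h.y_eq_zero hxy
      simp [h.toFun_some_zero hxy]
    · rw [h.toFun_some hxy hx]
      simp [hx]

theorem toFun_neg (h : IsogenyPair c W W') (P : W.Point) : h.toFun (-P) = -h.toFun P := by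
  rcases P with _ | ⟨x, y, hxy⟩
  · rfl
  · rw [h.neg_some]
    by_cases hx : x = 0
    · subst hx
      simp [h.toFun_some_zero]
    · rw [h.toFun_some _ hx, h.toFun_some _ hx, Point.neg_some]
      simp only [h.negY_eq', Point.some.injEq]
      constructor <;> ring

section Add

variable [DecidableEq K]

/-- Addition on `y² = x³ + a x² + b x`: the chord or tangent of slope `ℓ` through two points that
are not mutually inverse, with Vieta's formulas for the three intersection points. -/
theorem exists_add_eq (h : IsogenyPair c W W') {x₁ y₁ x₂ y₂ : K} (h₁ : W.Nonsingular x₁ y₁)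
    (h₂ : W.Nonsingular x₂ y₂) (hne : ¬(x₁ = x₂ ∧ y₁ = -y₂)) :
    ∃ ℓ m x₃ h₃, y₁ = ℓ * x₁ + m ∧ y₂ = ℓ * x₂ + m ∧ W.a₂ = ℓ ^ 2 - (x₁ + x₂ + x₃) ∧
      W.a₄ = x₁ * x₂ + x₁ * x₃ + x₂ * x₃ + 2 * ℓ * m ∧ m ^ 2 = x₁ * x₂ * x₃ ∧
      Point.some x₁ y₁ h₁ + .some x₂ y₂ h₂ = .some x₃ (-(ℓ * x₃ + m)) h₃ := by
  have hne' : ¬(x₁ = x₂ ∧ y₁ = W.negY x₂ y₂) := by rwa [h.negY_eq]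
  set ℓ := W.slope x₁ x₂ y₁ y₂ with hℓ
  have hx3 : W.addX x₁ x₂ ℓ = ℓ ^ 2 - W.a₂ - x₁ - x₂ := by rw [addX, h.a₁]; ring
  have hP := addPolynomial_slope h₁.1 h₂.1 hne'
  rw [← hℓ, hx3, addPolynomial_eq] at hP
  -- The quadratic coefficient is built into the definition of `x₃`; the values of the cubic at `0`
  -- and `1` supply the other two Vieta relations.
  have e0 := congrArg (Polynomial.eval 0) hP
  have e1 := congrArg (Polynomial.eval 1) hP
  simp only [Cubic.toPoly, h.a₁, h.a₃, h.a₆] at e0 e1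
  simp at e0 e1
  have hy3 : W.addY x₁ x₂ y₁ ℓ = -(ℓ * W.addX x₁ x₂ ℓ + (y₁ - ℓ * x₁)) := by
    rw [addY, negAddY, h.negY_eq]; ring
  refine ⟨ℓ, y₁ - ℓ * x₁, W.addX x₁ x₂ ℓ, ?_, by ring, ?_, ?_, ?_, ?_, ?_⟩
  · rw [← hy3]; exact nonsingular_add h₁ h₂ hne'
  · by_cases hx : x₁ = x₂
    · have := Y_eq_of_Y_ne h₁.1 h₂.1 hx (fun hy => hne' ⟨hx, hy⟩)
      rw [hx, this]; ring
    · have : ℓ * (x₁ - x₂) = y₁ - y₂ := by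
        rw [hℓ, slope_of_X_ne hx, div_mul_cancel₀ _ (sub_ne_zero.2 hx)]
      linear_combination this
  · rw [hx3]; ring
  · rw [hx3]; linear_combination e0 - e1
  · rw [hx3]; linear_combination e0
  · rw [Point.add_some hne']
    simp only [Point.some.injEq]
    exact ⟨rfl, hy3⟩

/-- Allows a guessed slope to be verified by polynomial identities: the chord or tangent relation
determines `ℓ`, because its coefficient is nonzero. -/
theorem add_eq_of_slope (h : IsogenyPair c W W') {x₁ y₁ x₂ y₂ x₃ y₃ ℓ : K}
    (h₁ : W'.Nonsingular x₁ y₁) (h₂ : W'.Nonsingular x₂ y₂) (h₃ : W'.Nonsingular x₃ y₃)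
    (hℓ : x₁ ≠ x₂ ∧ y₁ - y₂ = ℓ * (x₁ - x₂) ∨
      x₁ = x₂ ∧ y₁ = y₂ ∧ y₁ ≠ 0 ∧ 2 * y₁ * ℓ = 3 * x₁ ^ 2 + 2 * W'.a₂ * x₁ + W'.a₄)
    (hx₃ : x₃ = ℓ ^ 2 - W'.a₂ - x₁ - x₂) (hy₃ : y₃ = -(ℓ * (x₃ - x₁) + y₁)) :
    Point.some x₁ y₁ h₁ + .some x₂ y₂ h₂ = .some x₃ y₃ h₃ := by
  have hs : W'.slope x₁ x₂ y₁ y₂ = ℓ := by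
    rcases hℓ with ⟨hx, hl⟩ | ⟨hx, hy, hy0, hl⟩
    · rw [slope_of_X_ne hx, hl, mul_div_cancel_right₀ _ (sub_ne_zero.2 hx)]
    · have h2 : y₁ + y₁ ≠ 0 := by
        rw [← two_mul]; exact mul_ne_zero h.two_ne hy0
      rw [slope_of_Y_ne hx (by
        rw [h.negY_eq', ← hy]; intro h0; exact h2 (by linear_combination h0)), h.negY_eq',
        sub_neg_eq_add, div_eq_iff h2, h.a₁']
      linear_combination -hl
  have hne : ¬(x₁ = x₂ ∧ y₁ = W'.negY x₂ y₂) := by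
    rintro ⟨hx, hy⟩
    rw [h.negY_eq'] at hy
    rcases hℓ with ⟨hx', -⟩ | ⟨-, hy', hy0, -⟩
    · exact hx' hx
    · rw [← hy'] at hy
      refine mul_ne_zero h.two_ne hy0 (by linear_combination hy)
  rw [Point.add_some hne]
  have hX : W'.addX x₁ x₂ ℓ = x₃ := by rw [addX, h.a₁', hx₃]; ring
  simp only [Point.some.injEq, hs, hX, true_and]
  rw [addY, negAddY, h.negY_eq', hX, hy₃]

end Add

end IsogenyPair

end PointFormulas

/-! ### Additivity of the two-isogeny and the composite with its dual -/

section PointHoms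

open WeierstrassCurve.Affine

namespace IsogenyPair

variable {K : Type*} [Field K] [DecidableEq K] {c : K} {W W' : WeierstrassCurve.Affine K}

/-- A line through `(0, 0)` has `m = 0`, so Vieta's formula for the linear coefficient reduces to `x
x₃ = b`. -/
theorem add_zero_zero (h : IsogenyPair c W W') {x y : K} (hxy : W.Nonsingular x y) (hx : x ≠ 0) :
    ∃ h₁, Point.some x y hxy + .some 0 0 h.nonsingular_zero =
      .some (W.a₄ / x) (-(W.a₄ * y) / x ^ 2) h₁ := by
  obtain ⟨ℓ, m, x₃, h₃, e₁, e₂, ha, hb, hm, hadd⟩ := h.exists_add_eq hxy h.nonsingular_zero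
    (fun h0 => hx h0.1)
  obtain rfl : m = 0 := by linear_combination -e₂
  have hx₃ : x₃ = W.a₄ / x := by
    rw [hb]; field_simp; ring
  have hy₃ : -(ℓ * x₃ + 0) = -(W.a₄ * y) / x ^ 2 := by
    rw [hx₃, e₁]; field_simp; ring
  rw [hadd]
  subst hx₃
  rw [hy₃] at h₃
  exact ⟨h₃, by simp only [hy₃]⟩

theorem zero_zero_add_self (h : IsogenyPair c W W') :
    Point.some 0 0 h.nonsingular_zero + Point.some 0 0 h.nonsingular_zero = 0 :=
  Point.add_self_of_Y_eq (by rw [h.negY_eq, neg_zero])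

/-- Under `x ↦ b / x` the sum `x + a + b / x` is fixed, while `y / x` and `x - b / x` both change
sign. -/
theorem toFun_add_zero_zero (h : IsogenyPair c W W') (P : W.Point) :
    h.toFun (P + .some 0 0 h.nonsingular_zero) = h.toFun P := by
  rcases P with _ | ⟨x, y, hxy⟩
  · rw [← Point.zero_def, zero_add, h.toFun_zero, h.toFun_some_zero]
  · by_cases hx : x = 0
    · subst hx
      obtain rfl := h.y_eq_zero hxy
      rw [h.zero_zero_add_self, h.toFun_zero, h.toFun_some_zero]
    · obtain ⟨h₁, e⟩ := h.add_zero_zero hxy hx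
      have hb := h.a₄_ne
      rw [e, h.toFun_some _ (div_ne_zero hb hx), h.toFun_some _ hx]
      simp only [Point.some.injEq]
      constructor
      · field_simp
      · field_simp; ring

/-- The generic case of additivity. The images lie on a line of slope `c (ℓ - b / m)`; once `x₃`,
`a`, `b` and the ordinates are eliminated by Vieta's formulas, only rational identities in `x₁, x₂,
ℓ, m, c` remain. The last hypothesis says that the two images have a proper chord or a non-vertical
tangent. -/
theorem toFun_add_of_ne (h : IsogenyPair c W W') {x₁ y₁ x₂ y₂ x₃ ℓ m : K}
    (h₁ : W.Nonsingular x₁ y₁) (h₂ : W.Nonsingular x₂ y₂) (h₃ : W.Nonsingular x₃ (-(ℓ * x₃ + m)))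
    (n₁ : x₁ ≠ 0) (n₂ : x₂ ≠ 0) (n₃ : x₃ ≠ 0) (e₁ : y₁ = ℓ * x₁ + m) (e₂ : y₂ = ℓ * x₂ + m)
    (ha : W.a₂ = ℓ ^ 2 - (x₁ + x₂ + x₃))
    (hb : W.a₄ = x₁ * x₂ + x₁ * x₃ + x₂ * x₃ + 2 * ℓ * m) (hm : m ^ 2 = x₁ * x₂ * x₃)
    (hne : y₁ ^ 2 / x₁ ^ 2 ≠ y₂ ^ 2 / x₂ ^ 2 ∨ x₁ = x₂ ∧ y₁ * (x₁ ^ 2 - W.a₄) ≠ 0) :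
    h.toFun (.some x₁ y₁ h₁) + h.toFun (.some x₂ y₂ h₂) =
      h.toFun (.some x₃ (-(ℓ * x₃ + m)) h₃) := by
  have hc := h.c_ne
  have m0 : m ≠ 0 := by
    rintro rfl
    exact mul_ne_zero (mul_ne_zero n₁ n₂) n₃ (by rw [← hm]; ring)
  obtain rfl : x₃ = m ^ 2 / (x₁ * x₂) := by field_simp; linear_combination -hm
  rw [h.toFun_some _ n₁, h.toFun_some _ n₂, h.toFun_some _ n₃]
  apply h.add_eq_of_slope (ℓ := c * (ℓ - W.a₄ / m))
  · rcases hne with hne | ⟨rfl, hne⟩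
    · refine .inl ⟨fun h0 => hne (mul_left_cancel₀ (pow_ne_zero 2 hc) h0), ?_⟩
      rw [e₁, e₂, hb]
      field_simp
      ring
    · obtain rfl : y₁ = y₂ := by rw [e₁, e₂]
      refine .inr ⟨rfl, rfl, mul_ne_zero (pow_ne_zero 3 hc)
        (div_ne_zero hne (pow_ne_zero 2 n₁)), ?_⟩
      rw [h.a₂', h.a₄', e₁, ha, hb]
      field_simp
      ring
  · rw [h.a₂', e₁, e₂, ha, hb]
    field_simp
    ring
  · rw [e₁, hb]
    field_simp
    ring

theorem toFun_add_self (h : IsogenyPair c W W') (P : W.Point) :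
    h.toFun (P + P) = h.toFun P + h.toFun P := by
  rcases P with _ | ⟨x, y, hxy⟩
  · rw [← Point.zero_def, zero_add, h.toFun_zero, zero_add]
  by_cases hx : x = 0
  · subst hx
    obtain rfl := h.y_eq_zero hxy
    rw [h.zero_zero_add_self, h.toFun_some_zero, h.toFun_zero, zero_add]
  by_cases hy : y = 0
  · subst hy
    rw [Point.add_self_of_Y_eq (by rw [h.negY_eq, neg_zero]), h.toFun_zero, h.toFun_some _ hx,
      Point.add_self_of_Y_eq (by rw [h.negY_eq']; simp)]
  obtain ⟨ℓ, m, x₃, h₃, e₁, -, ha, hb, hm, hadd⟩ := h.exists_add_eq hxy hxy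
    (fun h0 => mul_ne_zero h.two_ne hy (by linear_combination h0.2))
  rw [hadd]
  by_cases hx₃ : x₃ = 0
  · subst hx₃
    have m0 : m = 0 := pow_eq_zero_iff two_ne_zero |>.1 (by rw [hm]; ring)
    rw [h.toFun_some_zero, h.toFun_some _ hx, Point.add_self_of_Y_eq]
    rw [h.negY_eq', hb, m0]
    ring
  · refine (h.toFun_add_of_ne hxy hxy h₃ hx hx hx₃ e₁ e₁ ha hb hm
      (.inr ⟨rfl, mul_ne_zero hy fun h0 => ?_⟩)).symm
    -- If `x² = b`, Vieta's formulas give `x x₃ + ℓ m = 0` and then `m y = 0`. But `m = 0` would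
    -- force `x² x₃ = 0`, and `y = 0` is excluded.
    have h1 : 2 * x * (x * x₃ + ℓ * m) = 0 := by rw [hb] at h0; linear_combination -x * h0
    have h2 : x * x₃ + ℓ * m = 0 := by
      simpa [h.two_ne, hx] using h1
    have h3 : m * y = 0 := by rw [e₁]; linear_combination x * h2 + hm
    rcases mul_eq_zero.1 h3 with h3 | h3
    · rw [h3] at hm
      exact mul_ne_zero (mul_ne_zero hx hx) hx₃ (by rw [← hm]; ring)
    · exact hy h3

/-- The chord rule needs images with distinct abscissas. These coincide only for `Q = ±P` or `Q = ±P
+ T`, so these cases and `P, Q ∈ {O, T}` are removed beforehand. -/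
theorem toFun_add (h : IsogenyPair c W W') (P Q : W.Point) :
    h.toFun (P + Q) = h.toFun P + h.toFun Q := by
  set T := Point.some 0 0 h.nonsingular_zero with hT
  have hTT : T + T = 0 := h.zero_zero_add_self
  have hfT : h.toFun T = 0 := h.toFun_some_zero _
  by_cases hP : P = 0
  · rw [hP, zero_add, h.toFun_zero, zero_add]
  by_cases hQ : Q = 0
  · rw [hQ, add_zero, h.toFun_zero, add_zero]
  by_cases hPT : P = T
  · rw [hPT, add_comm, h.toFun_add_zero_zero, hfT, zero_add]
  by_cases hQT : Q = T
  · rw [hQT, h.toFun_add_zero_zero, hfT, add_zero]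
  by_cases hPQ : P = Q
  · rw [hPQ, h.toFun_add_self]
  by_cases hPQT : Q = P + T
  · rw [hPQT, ← add_assoc, h.toFun_add_zero_zero, h.toFun_add_zero_zero, h.toFun_add_self]
  by_cases hS : P + Q = 0
  · rw [hS, h.toFun_zero, ← neg_eq_of_add_eq_zero_right hS, h.toFun_neg, add_neg_cancel]
  by_cases hST : P + Q = T
  · have : Q = -P + T := by rw [← hST]; abel
    rw [hST, hfT, this, h.toFun_add_zero_zero, h.toFun_neg, add_neg_cancel]
  rcases P with _ | ⟨x₁, y₁, h₁⟩
  · exact absurd rfl hP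
  rcases Q with _ | ⟨x₂, y₂, h₂⟩
  · exact absurd rfl hQ
  have n₁ : x₁ ≠ 0 := by
    rintro rfl
    obtain rfl := h.y_eq_zero h₁
    exact hPT rfl
  have n₂ : x₂ ≠ 0 := by
    rintro rfl
    obtain rfl := h.y_eq_zero h₂
    exact hQT rfl
  have hne : ¬(x₁ = x₂ ∧ y₁ = -y₂) := by
    rintro ⟨rfl, rfl⟩
    exact hS (by rw [← h.neg_some h₂, neg_add_cancel])
  obtain ⟨ℓ, m, x₃, h₃, e₁, e₂, ha, hb, hm, hadd⟩ := h.exists_add_eq h₁ h₂ hne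
  have n₃ : x₃ ≠ 0 := by
    rintro rfl
    have hy := h.y_eq_zero h₃
    rw [hadd] at hST
    exact hST (by simp only [hT, hy])
  rw [hadd]
  refine (h.toFun_add_of_ne h₁ h₂ h₃ n₁ n₂ n₃ e₁ e₂ ha hb hm (.inl fun hX => ?_)).symm
  have hx : x₁ ≠ x₂ := by
    rintro rfl
    exact hPQ (by simp only [e₁, e₂])
  have q₁ := (h.nonsingular_iff _ _).1 h₁
  have q₂ := (h.nonsingular_iff _ _).1 h₂
  -- Equality of `x + a + b / x` at two distinct abscissas means that their product is `b`, so `Q`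
  -- has the abscissa of `P + T`. The sign relating the ratios `y / x` then decides between `Q = -(P
  -- + T)` and `Q = P + T`, both already excluded.
  have hprod : x₁ * x₂ = W.a₄ := by
    rw [q₁, q₂] at hX
    field_simp at hX
    have : (x₁ - x₂) * (x₁ * x₂ - W.a₄) = 0 := by linear_combination hX
    exact sub_eq_zero.1 ((mul_eq_zero.1 this).resolve_left (sub_ne_zero.2 hx))
  obtain ⟨h₄, e₄⟩ := h.add_zero_zero h₁ n₁
  have hx₂ : x₂ = W.a₄ / x₁ := by rw [← hprod]; field_simp
  rw [← div_pow, ← div_pow, sq_eq_sq_iff_eq_or_eq_neg] at hX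
  rcases hX with hX | hX
  · have hy₂ : y₂ = W.a₄ * y₁ / x₁ ^ 2 := by
      rw [← hprod]; field_simp at hX ⊢; linear_combination -hX
    have : Point.some x₂ y₂ h₂ = -(Point.some x₁ y₁ h₁ + T) := by
      rw [e₄, h.neg_some]
      simp only [hx₂, hy₂, Point.some.injEq, true_and]
      ring
    apply hST
    rw [this, neg_add, ← add_assoc, add_neg_cancel, zero_add, neg_eq_iff_add_eq_zero, hTT]
  · apply hPQT
    rw [e₄]
    simp only [hx₂, Point.some.injEq, true_and]
    rw [← hprod]
    field_simp at hX ⊢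
    linear_combination hX

/-- The two-isogeny with kernel `{O, (0,0)}` on points. -/
noncomputable def hom (h : IsogenyPair c W W') : W.Point →+ W'.Point where
  toFun := h.toFun
  map_zero' := h.toFun_zero
  map_add' := h.toFun_add

theorem hom_some (h : IsogenyPair c W W') {x y : K} (hxy : W.Nonsingular x y) (hx : x ≠ 0) :
    h.hom (.some x y hxy) = .some _ _ (h.map_nonsingular hx hxy) := h.toFun_some hxy hx

theorem hom_eq_zero_iff (h : IsogenyPair c W W') (P : W.Point) :
    h.hom P = 0 ↔ P = 0 ∨ P = .some 0 0 h.nonsingular_zero := h.toFun_eq_zero_iff P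

/-- Away from `x y = 0` the composite has abscissa `(c c')² ((x² - b) / y)²`, which for `2 c c' = 1`
is the duplication formula. A point with `y = 0`, `x ≠ 0` goes to `(0, 0)`, which the second isogeny
kills. -/
theorem hom_hom (h : IsogenyPair c W W') {c' : K} (h' : IsogenyPair c' W' W)
    (hc : 2 * c * c' = 1) (P : W.Point) : h'.hom (h.hom P) = 2 • P := by
  rw [two_nsmul]
  rcases P with _ | ⟨x, y, hxy⟩
  · rw [← Point.zero_def, map_zero, map_zero, zero_add]
  by_cases hx : x = 0
  · subst hx
    obtain rfl := h.y_eq_zero hxy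
    rw [h.zero_zero_add_self, (h.hom_eq_zero_iff _).2 (.inr rfl), map_zero]
  rw [h.hom_some hxy hx]
  by_cases hy : y = 0
  · subst hy
    rw [Point.add_self_of_Y_eq (by rw [h.negY_eq, neg_zero]), h'.hom_eq_zero_iff]
    right
    simp
  have c0 := h.c_ne
  have two0 := h.two_ne
  rw [h'.hom_some _ (mul_ne_zero (pow_ne_zero 2 c0)
    (div_ne_zero (pow_ne_zero 2 hy) (pow_ne_zero 2 hx)))]
  obtain rfl : c' = 1 / (2 * c) := by field_simp; linear_combination hc
  have q := (h.nonsingular_iff _ _).1 hxy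
  have hb : W.a₄ = y ^ 2 / x - x ^ 2 - W.a₂ * x := by
    field_simp
    linear_combination -q
  symm
  apply h'.add_eq_of_slope (ℓ := (3 * x ^ 2 + 2 * W.a₂ * x + W.a₄) / (2 * y))
  · right
    refine ⟨rfl, rfl, hy, ?_⟩
    field_simp
  · rw [hb]
    field_simp
    ring
  · rw [h.a₄', hb]
    field_simp
    ring

end IsogenyPair

end PointHoms

/-! ### Function fields of Weierstrass curves -/

section FunctionFields

open WeierstrassCurve.Affine

variable {F : Type*} [Field F] (W : WeierstrassCurve.Affine F)

theorem eval₂_xGen (p : F[X]) : p.eval₂ (algebraMap F W.FunctionField) (xGen W) =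
    algebraMap W.CoordinateRing W.FunctionField (CoordinateRing.mk W (C p)) := by
  have e : algebraMap F W.FunctionField = ((algebraMap W.CoordinateRing W.FunctionField).comp
    (CoordinateRing.mk W)).comp ((C : F[X] →+* F[X][X]).comp C) := rfl
  rw [e, xGen]
  induction p using Polynomial.induction_on' with
  | add p q hp hq => simp only [eval₂_add, hp, hq, map_add]
  | monomial n a => simp [← C_mul_X_pow_eq_monomial]

/-- The coordinate ring is free over `F[X]` with basis `1, y`, so no nonzero polynomial in `x`
vanishes in it. -/
theorem transcendental_xGen : Transcendental F (xGen W) := by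
  rw [transcendental_iff]
  intro p hp
  rw [aeval_def, eval₂_xGen] at hp
  have h3 := (map_eq_zero_iff _ (IsFractionRing.injective W.CoordinateRing W.FunctionField)).1 hp
  have h4 := CoordinateRing.smul_basis_eq_zero (W' := W) (p := p) (q := 0)
    (by rw [CoordinateRing.smul, h3]; simp)
  exact h4.1

variable {W}

theorem subfield_eq_top (S : Subfield W.FunctionField)
    (hF : ∀ a, algebraMap F W.FunctionField a ∈ S) (hx : xGen W ∈ S) (hy : yGen W ∈ S) :
    S = ⊤ := by
  have hp : ∀ p : F[X], p.eval₂ (algebraMap F W.FunctionField) (xGen W) ∈ S := by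
    intro p
    rw [eval₂_eq_sum_range]
    exact sum_mem fun i _ => mul_mem (hF _) (pow_mem hx _)
  have hR : ∀ r : W.CoordinateRing, algebraMap W.CoordinateRing W.FunctionField r ∈ S := by
    intro r
    obtain ⟨p, q, rfl⟩ := CoordinateRing.exists_smul_basis_eq r
    rw [CoordinateRing.smul, CoordinateRing.smul, mul_one, map_add, map_mul, ← eval₂_xGen,
      ← eval₂_xGen]
    exact add_mem (hp p) (mul_mem (hp q) hy)
  rw [eq_top_iff]
  intro z _
  obtain ⟨a, b, -, rfl⟩ := IsFractionRing.div_surjective (A := W.CoordinateRing) z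
  exact div_mem (hR a) (hR b)

theorem functionField_hom_ext {L : Type*} [Field L] {f g : W.FunctionField →+* L}
    (hF : ∀ a, f (algebraMap F _ a) = g (algebraMap F _ a)) (hx : f (xGen W) = g (xGen W))
    (hy : f (yGen W) = g (yGen W)) : f = g := by
  have h := subfield_eq_top (f.eqLocusField g) hF hx hy
  ext z
  have : z ∈ f.eqLocusField g := h ▸ Subfield.mem_top z
  exact this

/-- A ring homomorphism from the function field is given by a generic point over the target. -/
theorem exists_functionField_hom {L : Type*} [Field L] (g : F →+* L) {x y : L}
    (hxy : (W.map g).Equation x y) (hx : ∀ p : F[X], p.eval₂ g x = 0 → p = 0) :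
    ∃ f : W.FunctionField →+* L, (∀ a, f (algebraMap F _ a) = g a) ∧ f (xGen W) = x ∧
      f (yGen W) = y := by
  let i : F[X] →+* L := eval₂RingHom g x
  have hev : W.polynomial.eval₂ i y = 0 := by
    rw [eval₂_eval₂RingHom_apply, ← map_polynomial]
    exact hxy
  let f₀ : W.CoordinateRing →+* L := AdjoinRoot.lift i y hev
  have hC : ∀ p : F[X], f₀ (CoordinateRing.mk W (C p)) = p.eval₂ g x := fun p =>
    AdjoinRoot.lift_of hev
  have hinj : Function.Injective f₀ := by
    rw [RingHom.injective_iff_ker_eq_bot]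
    -- In an integral extension of `F[X]` a nonzero ideal of a domain meets `F[X]` nontrivially, so
    -- injectivity on polynomials in `x` suffices.
    have : Algebra.IsIntegral F[X] W.CoordinateRing := by
      have := (AdjoinRoot.powerBasis' (monic_polynomial (W := W))).finite
      exact Algebra.IsIntegral.of_finite _ _
    refine Ideal.eq_bot_of_comap_eq_bot (R := F[X]) ?_
    rw [eq_bot_iff]
    intro p hp
    exact hx p ((hC p).symm.trans hp)
  refine ⟨IsFractionRing.lift hinj, fun a => ?_, ?_, ?_⟩
  · have : algebraMap F W.FunctionField a = algebraMap W.CoordinateRing W.FunctionField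
      (CoordinateRing.mk W (C (C a))) := rfl
    rw [this, IsFractionRing.lift_algebraMap, hC, eval₂_C]
  · rw [xGen, IsFractionRing.lift_algebraMap, hC, eval₂_X]
  · rw [yGen, IsFractionRing.lift_algebraMap]
    exact AdjoinRoot.lift_root hev

theorem exists_functionField_algHom {L : Type*} [Field L] [Algebra F L] {x y : L}
    (hxy : (W.map (algebraMap F L)).Equation x y) (hx : Transcendental F x) :
    ∃ f : W.FunctionField →ₐ[F] L, f (xGen W) = x ∧ f (yGen W) = y := by
  obtain ⟨f, hF, h⟩ := exists_functionField_hom (algebraMap F L) hxy (transcendental_iff.1 hx)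
  exact ⟨{ f with commutes' := hF }, h⟩

/-- If `k` fixes the image of `φ`, and `L` is generated over this image by `s` with `s ^ 2` in the
image and `k s = -s`, then `L` is spanned by `1` and `s` over the image. -/
theorem exists_eq_add_mul {N L : Type*} [Field N] [Field L] (φ : N →+* L)
    (k : L →+* L) {s : L} (hφ : ∀ a, k (φ a) = φ a) (hs : k s = -s) (hs2 : s ^ 2 ∈ φ.range)
    (hgen : ∀ S : Subfield L, (∀ a, φ a ∈ S) → s ∈ S → S = ⊤) (f : L) :
    ∃ a b, f = φ a + φ b * s := by
  obtain ⟨d, hd⟩ := hs2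
  let S : Subfield L :=
    { carrier := {f | ∃ a b, f = φ a + φ b * s}
      zero_mem' := ⟨0, 0, by simp⟩
      one_mem' := ⟨1, 0, by simp⟩
      add_mem' := by
        rintro _ _ ⟨a, b, rfl⟩ ⟨a', b', rfl⟩
        exact ⟨a + a', b + b', by simp only [map_add]; ring⟩
      neg_mem' := by
        rintro _ ⟨a, b, rfl⟩
        exact ⟨-a, -b, by simp only [map_neg]; ring⟩
      mul_mem' := by
        rintro _ _ ⟨a, b, rfl⟩ ⟨a', b', rfl⟩
        refine ⟨a * a' + b * b' * d, a * b' + b * a', ?_⟩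
        simp only [map_add, map_mul, hd]
        ring
      inv_mem' := by
        rintro _ ⟨a, b, rfl⟩
        by_cases h0 : φ a + φ b * s = 0
        · exact ⟨0, 0, by simp [h0]⟩
        -- The conjugate is nonzero because `k` carries it back to the nonzero element; the inverse
        -- is then the conjugate divided by the norm.
        have h1 : φ a - φ b * s ≠ 0 := by
          intro h1
          apply h0
          have := congrArg k h1
          rw [map_sub, map_mul, hφ, hφ, hs, map_zero] at this
          linear_combination this
        refine ⟨a / (a ^ 2 - b ^ 2 * d), -b / (a ^ 2 - b ^ 2 * d), ?_⟩
        have h2 : φ a ^ 2 - φ b ^ 2 * s ^ 2 ≠ 0 := by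
          have := mul_ne_zero h0 h1
          intro h3
          exact this (by linear_combination h3)
        simp only [map_div₀, map_sub, map_pow, map_mul, map_neg, hd]
        field_simp
        ring }
  have hS : S = ⊤ := hgen S (fun a => ⟨a, 0, by simp⟩) ⟨0, 1, by simp⟩
  have : f ∈ S := hS ▸ Subfield.mem_top f
  exact this

/-- Writing an element as `φ a + φ b * s`, the map `k` changes only the sign of the second term, so
a fixed element has no `s`-part in characteristic zero. -/
theorem fixed_iff_mem_range {N L : Type*} [Field N] [Field L] [CharZero L] (φ : N →+* L)
    (k : L →+* L) {s : L} (hφ : ∀ a, k (φ a) = φ a) (hs : k s = -s)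
    (hs2 : s ^ 2 ∈ φ.range)
    (hgen : ∀ S : Subfield L, (∀ a, φ a ∈ S) → s ∈ S → S = ⊤) (f : L) :
    k f = f ↔ f ∈ Set.range φ := by
  constructor
  · intro hf
    obtain ⟨a, b, rfl⟩ := exists_eq_add_mul φ k hφ hs hs2 hgen f
    rw [map_add, map_mul, hφ, hφ, hs] at hf
    have : 2 * (φ b * s) = 0 := by linear_combination -hf
    have : φ b * s = 0 := by simpa using this
    exact ⟨a, by rw [this, add_zero]⟩
  · rintro ⟨a, rfl⟩
    exact hφ a

theorem finrank_fieldRange_eq_two {F N L : Type*} [Field F] [Field N] [Field L] [CharZero L]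
    [Algebra F N] [Algebra F L] (φ : N →ₐ[F] L) (k : L →+* L) {s : L} (hφ : ∀ a, k (φ a) = φ a)
    (hs : k s = -s) (hs0 : s ≠ 0) (hs2 : s ^ 2 ∈ (φ : N →+* L).range)
    (hgen : ∀ S : Subfield L, (∀ a, φ a ∈ S) → s ∈ S → S = ⊤) :
    Module.finrank φ.fieldRange L = 2 := by
  have hli : LinearIndependent φ.fieldRange ![(1 : L), s] := by
    rw [LinearIndependent.pair_iff]
    rintro ⟨_, a, rfl⟩ ⟨_, b, rfl⟩ h
    have h1 : φ a + φ b * s = 0 := by simpa [Algebra.smul_def] using h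
    have h2 := congrArg k h1
    rw [map_add, map_mul, hφ, hφ, hs, map_zero] at h2
    have h3 : 2 * (φ b * s) = 0 := by linear_combination h1 - h2
    have h4 : φ b = 0 := by simpa [hs0] using h3
    have h5 : φ a = 0 := by rw [h4] at h1; linear_combination h1
    exact ⟨Subtype.ext h5, Subtype.ext h4⟩
  have hsp : ⊤ ≤ Submodule.span φ.fieldRange (Set.range ![(1 : L), s]) := by
    intro f _
    obtain ⟨a, b, rfl⟩ := exists_eq_add_mul (φ : N →+* L) k hφ hs hs2 hgen f
    rw [Matrix.range_cons_cons_empty, Submodule.mem_span_pair]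
    refine ⟨⟨φ a, a, rfl⟩, ⟨φ b, b, rfl⟩, ?_⟩
    simp [Algebra.smul_def]
  rw [Module.finrank_eq_card_basis (Module.Basis.mk hli hsp), Fintype.card_fin]

end FunctionFields

/-! ### The isogeny and the translation at the generic point -/

section GenericPoint

open WeierstrassCurve.Affine

theorem transcendental_div {F L : Type*} [Field F] [Field L] [Algebra F L] {x : L}
    (hx : Transcendental F x) {b : F} (hb : b ≠ 0) : Transcendental F (algebraMap F L b / x) := by
  intro hs
  have hb' : algebraMap F L b ≠ 0 := by simpa using hb
  refine hx ?_
  have := (isAlgebraic_algebraMap (A := L) b).mul hs.inv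
  rwa [inv_div, mul_div_cancel₀ _ hb'] at this

/-- If the image abscissa were algebraic, so would be `t = x + b / x`; but `x` is a root of `X² - t
X + b`, so it would be algebraic too. -/
theorem transcendental_isogeny {F L : Type*} [Field F] [Field L] [Algebra F L] {a b c : F} {x y : L}
    (hx : Transcendental F x) (hc : c ≠ 0)
    (hxy : y ^ 2 = x ^ 3 + algebraMap F L a * x ^ 2 + algebraMap F L b * x) :
    Transcendental F (algebraMap F L c ^ 2 * (y ^ 2 / x ^ 2)) := by
  intro hs
  have hx0 : x ≠ 0 := fun h0 => hx (h0 ▸ isAlgebraic_zero)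
  have hc' : IsAlgebraic F (algebraMap F L c ^ 2)⁻¹ := ((isAlgebraic_algebraMap c).pow 2).inv
  have hs' : IsAlgebraic F (x + algebraMap F L b / x) := by
    have hc0 : algebraMap F L c ≠ 0 := by simpa using hc
    have e : x + algebraMap F L b / x = (algebraMap F L c ^ 2)⁻¹ *
        (algebraMap F L c ^ 2 * (y ^ 2 / x ^ 2)) - algebraMap F L a := by
      rw [hxy]
      field_simp
      ring
    rw [e]
    exact (hc'.mul hs).sub (isAlgebraic_algebraMap a)
  set t := x + algebraMap F L b / x with ht
  have : Algebra.IsAlgebraic F (IntermediateField.adjoin F {t}) :=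
    IntermediateField.isAlgebraic_adjoin (by simpa using hs'.isIntegral)
  refine hx (IsAlgebraic.restrictScalars F (S := IntermediateField.adjoin F {t})
    ⟨X ^ 2 - C ⟨t, IntermediateField.mem_adjoin_simple_self F t⟩ * X +
      C (algebraMap F _ b), fun hp => ?_, ?_⟩)
  · simpa using congrArg (coeff · 2) hp
  · simp only [map_add, map_sub, map_mul, map_pow, aeval_X, aeval_C,
      ← IsScalarTower.algebraMap_apply, IntermediateField.algebraMap_apply]
    rw [ht]
    field_simp
    ring

theorem point_some_congr {R : Type*} [CommRing R] {W : WeierstrassCurve.Affine R} {x y x' y' : R}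
    {h : W.Nonsingular x y} {h' : W.Nonsingular x' y'} (hx : x = x') (hy : y = y') :
    Point.some x y h = Point.some x' y' h' := by
  subst hx hy
  rfl

variable {F : Type v} [Field F]

theorem mapPoint_some (W : WeierstrassCurve.Affine F) {L M : Type*} [Field L] [Field M]
    [Algebra F L] [Algebra F M] (f : L →ₐ[F] M) {x y : L}
    (h : (WeierstrassCurve.Affine.baseChange W L).Nonsingular x y) :
    mapPoint W f (.some x y h) =
      .some (f x) (f y) ((W.baseChange_nonsingular f.injective ..).mpr h) := rfl

theorem xGen_ne (W : WeierstrassCurve.Affine F) : xGen W ≠ 0 := fun h0 =>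
  transcendental_xGen W (h0 ▸ isAlgebraic_zero)

variable [CharZero F] {c : F} {W W' : WeierstrassCurve.Affine F}

namespace IsogenyPair

theorem generic_equation (h : IsogenyPair c W W') : yGen W ^ 2 = xGen W ^ 3 +
    algebraMap F _ W.a₂ * xGen W ^ 2 + algebraMap F _ W.a₄ * xGen W :=
  ((h.map (algebraMap F W.FunctionField)).nonsingular_iff _ _).1 (generic_nonsingular W)

theorem yGen_ne (h : IsogenyPair c W W') : yGen W ≠ 0 := by
  intro h0
  refine transcendental_xGen W ⟨X ^ 3 + C W.a₂ * X ^ 2 + C W.a₄ * X, fun hp => h.a₄_ne ?_, ?_⟩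
  · simpa using congrArg (coeff · 1) hp
  · have := h.generic_equation
    simp [h0] at this
    simp [← this]

/-- The isogeny applied to the generic point of `W` gives a point of `W'` with transcendental
abscissa, which is the same as an embedding of function fields. -/
theorem exists_hom (h : IsogenyPair c W W') : ∃ φ : W'.FunctionField →ₐ[F] W.FunctionField,
    φ (xGen W') = algebraMap F _ c ^ 2 * (yGen W ^ 2 / xGen W ^ 2) ∧
    φ (yGen W') = algebraMap F _ c ^ 3 *
      (yGen W * (xGen W ^ 2 - algebraMap F _ W.a₄) / xGen W ^ 2) :=
  exists_functionField_algHom ((h.map (algebraMap F W.FunctionField)).map_nonsingular (xGen_ne W)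
    (generic_nonsingular W)).1
    (transcendental_isogeny (transcendental_xGen W) h.c_ne h.generic_equation)

theorem exists_translation (h : IsogenyPair c W W') :
    ∃ k : W.FunctionField ≃ₐ[F] W.FunctionField,
      k (xGen W) = algebraMap F _ W.a₄ / xGen W ∧
      k (yGen W) = -(algebraMap F _ W.a₄ * yGen W) / xGen W ^ 2 := by
  classical
  have hb : algebraMap F W.FunctionField W.a₄ ≠ 0 := by simpa using h.a₄_ne
  have hx := xGen_ne W
  obtain ⟨h₁, -⟩ := (h.map (algebraMap F W.FunctionField)).add_zero_zero
    (generic_nonsingular W) hx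
  obtain ⟨k, kx, ky⟩ := exists_functionField_algHom h₁.1
    (transcendental_div (transcendental_xGen W) h.a₄_ne)
  change k (xGen W) = algebraMap F _ W.a₄ / xGen W at kx
  change k (yGen W) = -(algebraMap F _ W.a₄ * yGen W) / xGen W ^ 2 at ky
  have hk : k.comp k = AlgHom.id F _ := by
    have : ((k.comp k : W.FunctionField →ₐ[F] W.FunctionField) : W.FunctionField →+* _) =
        RingHom.id _ := by
      refine functionField_hom_ext (fun a => ?_) ?_ ?_
      · exact (k.comp k).commutes a
      · simp [kx]
        field_simp
      · simp [kx, ky]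
        field_simp
    exact AlgHom.coe_ringHom_injective this
  exact ⟨AlgEquiv.ofAlgHom k k hk hk, kx, ky⟩

theorem isTranslationBy (h : IsogenyPair c W W')
    (hT : (WeierstrassCurve.Affine.baseChange W F).Nonsingular 0 0)
    {k : W.FunctionField ≃ₐ[F] W.FunctionField}
    (kx : k (xGen W) = algebraMap F _ W.a₄ / xGen W)
    (ky : k (yGen W) = -(algebraMap F _ W.a₄ * yGen W) / xGen W ^ 2) :
    IsTranslationBy W (.some 0 0 hT) k := by
  obtain ⟨h₁, e⟩ := (h.map (algebraMap F W.FunctionField)).add_zero_zero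
    (generic_nonsingular W) (xGen_ne W)
  unfold IsTranslationBy genericPoint
  rw [mapPoint_some, mapPoint_some]
  have e0 : Algebra.ofId F W.FunctionField 0 = 0 := map_zero _
  simp only [e0]
  refine Eq.trans ?_ (Eq.trans e.symm ?_)
  · exact point_some_congr kx ky
  · congr 1

theorem addOrderOf_zero_zero (h : IsogenyPair c W W')
    (hT : (WeierstrassCurve.Affine.baseChange W F).Nonsingular 0 0) [DecidableEq F] :
    addOrderOf (Point.some 0 0 hT : (WeierstrassCurve.Affine.baseChange W F).Point) = 2 := by
  refine addOrderOf_eq_prime ?_ (Point.some_ne_zero hT)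
  rw [two_nsmul]
  exact (h.map (algebraMap F F)).zero_zero_add_self

theorem orderOf_translation (h : IsogenyPair c W W') {k : W.FunctionField ≃ₐ[F] W.FunctionField}
    (kx : k (xGen W) = algebraMap F _ W.a₄ / xGen W)
    (ky : k (yGen W) = -(algebraMap F _ W.a₄ * yGen W) / xGen W ^ 2) : orderOf k = 2 := by
  have hb : algebraMap F W.FunctionField W.a₄ ≠ 0 := by simpa using h.a₄_ne
  have hx := xGen_ne W
  have hy := h.yGen_ne
  refine orderOf_eq_prime ?_ ?_
  · have : ((k.toAlgHom.comp k.toAlgHom : W.FunctionField →ₐ[F] W.FunctionField) :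
        W.FunctionField →+* _) = RingHom.id _ := by
      refine functionField_hom_ext (fun a => ?_) ?_ ?_
      · simp
      · simp [kx]
        field_simp
      · simp [kx, ky]
        field_simp
    ext z
    rw [pow_two]
    exact congrArg (fun f : W.FunctionField →+* W.FunctionField => f z) this
  · intro h1
    -- The translation is not the identity because it negates the nonzero function `y / x`.
    have h2 : k (yGen W / xGen W) = yGen W / xGen W := by rw [h1]; rfl
    have h3 : k (yGen W / xGen W) = -(yGen W / xGen W) := by
      rw [map_div₀, kx, ky]
      field_simp
    rw [h2] at h3
    have : algebraMap F W.FunctionField 2 * (yGen W / xGen W) = 0 := by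
      rw [map_ofNat]
      linear_combination h3
    exact mul_ne_zero (by simpa only [map_zero] using
      (algebraMap F W.FunctionField).injective.ne h.two_ne) (div_ne_zero hy hx) this

theorem translation_slope (h : IsogenyPair c W W') {k : W.FunctionField ≃ₐ[F] W.FunctionField}
    (kx : k (xGen W) = algebraMap F _ W.a₄ / xGen W)
    (ky : k (yGen W) = -(algebraMap F _ W.a₄ * yGen W) / xGen W ^ 2) :
    k (yGen W / xGen W) = -(yGen W / xGen W) := by
  have hb : algebraMap F W.FunctionField W.a₄ ≠ 0 := by simpa using h.a₄_ne
  have hx := xGen_ne W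
  rw [map_div₀, kx, ky]
  field_simp

end IsogenyPair

end GenericPoint

/-! ### The isogeny on function fields: fixed field, degree, duality, and surjectivity over closed
fields -/

section GenericIsogeny

open WeierstrassCurve.Affine

variable {F : Type v} [Field F] [CharZero F] {c : F} {W W' : WeierstrassCurve.Affine F}

namespace IsogenyPair

variable {φ : W'.FunctionField →ₐ[F] W.FunctionField}

theorem slope_sq (h : IsogenyPair c W W') : (yGen W / xGen W) ^ 2 =
    xGen W + algebraMap F _ W.a₂ + algebraMap F _ W.a₄ / xGen W := by
  have hx := xGen_ne W
  rw [div_pow, h.generic_equation]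
  field_simp

/-- With `s = y / x`, the sum of `s² - a = x + b / x` and `φ y' / (c³ s) = x - b / x` is `2 x`, and
`y = s x`; so the image of `φ` and `s` generate everything. -/
theorem subfield_eq_top_of_slope_mem (h : IsogenyPair c W W')
    (hφy : φ (yGen W') = algebraMap F _ c ^ 3 *
      (yGen W * (xGen W ^ 2 - algebraMap F _ W.a₄) / xGen W ^ 2))
    (S : Subfield W.FunctionField) (hS : ∀ a, φ a ∈ S) (hs : yGen W / xGen W ∈ S) : S = ⊤ := by
  have hx := xGen_ne W
  have hy := h.yGen_ne
  have hc : algebraMap F W.FunctionField c ≠ 0 := by simpa using h.c_ne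
  have two0 : (2 : W.FunctionField) ≠ 0 := by
    simpa only [map_ofNat] using (map_ne_zero (algebraMap F W.FunctionField)).2 h.two_ne
  have hF : ∀ a, algebraMap F W.FunctionField a ∈ S := fun a => by
    rw [← φ.commutes a]; exact hS _
  have hxS : xGen W ∈ S := by
    have e : xGen W = (φ (yGen W') / (algebraMap F _ c ^ 3 * (yGen W / xGen W)) +
        ((yGen W / xGen W) ^ 2 - algebraMap F _ W.a₂)) / algebraMap F _ 2 := by
      rw [h.slope_sq, hφy, map_ofNat]
      field_simp
      ring
    rw [e]
    exact div_mem (add_mem (div_mem (hS _) (mul_mem (pow_mem (hF c) 3) hs))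
      (sub_mem (pow_mem hs 2) (hF _))) (hF 2)
  refine subfield_eq_top S hF hxS ?_
  have e : yGen W = yGen W / xGen W * xGen W := by field_simp
  rw [e]
  exact mul_mem hs hxS

theorem translation_comp (h : IsogenyPair c W W') {k : W.FunctionField ≃ₐ[F] W.FunctionField}
    (kx : k (xGen W) = algebraMap F _ W.a₄ / xGen W)
    (ky : k (yGen W) = -(algebraMap F _ W.a₄ * yGen W) / xGen W ^ 2)
    (hφx : φ (xGen W') = algebraMap F _ c ^ 2 * (yGen W ^ 2 / xGen W ^ 2))
    (hφy : φ (yGen W') = algebraMap F _ c ^ 3 *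
      (yGen W * (xGen W ^ 2 - algebraMap F _ W.a₄) / xGen W ^ 2)) (a : W'.FunctionField) :
    k (φ a) = φ a := by
  have hb : algebraMap F W.FunctionField W.a₄ ≠ 0 := by simpa using h.a₄_ne
  have hx := xGen_ne W
  have : ((k.toAlgHom.comp φ : W'.FunctionField →ₐ[F] W.FunctionField) :
      W'.FunctionField →+* W.FunctionField) = (φ : W'.FunctionField →+* W.FunctionField) := by
    refine functionField_hom_ext (fun a => ?_) ?_ ?_
    · simp
    · simp [hφx, kx, ky]
      left
      field_simp
    · simp [hφy, kx, ky]
      left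
      field_simp
      ring
  exact congrArg (fun f : W'.FunctionField →+* W.FunctionField => f a) this

theorem slope_sq_mem_range (h : IsogenyPair c W W')
    (hφx : φ (xGen W') = algebraMap F _ c ^ 2 * (yGen W ^ 2 / xGen W ^ 2)) :
    (yGen W / xGen W) ^ 2 ∈ (φ : W'.FunctionField →+* W.FunctionField).range := by
  have hc : algebraMap F W.FunctionField c ≠ 0 := by simpa using h.c_ne
  refine ⟨xGen W' / algebraMap F _ c ^ 2, ?_⟩
  simp [hφx]
  field_simp

theorem translation_fixed_iff (h : IsogenyPair c W W')
    {k : W.FunctionField ≃ₐ[F] W.FunctionField}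
    (kx : k (xGen W) = algebraMap F _ W.a₄ / xGen W)
    (ky : k (yGen W) = -(algebraMap F _ W.a₄ * yGen W) / xGen W ^ 2)
    (hφx : φ (xGen W') = algebraMap F _ c ^ 2 * (yGen W ^ 2 / xGen W ^ 2))
    (hφy : φ (yGen W') = algebraMap F _ c ^ 3 *
      (yGen W * (xGen W ^ 2 - algebraMap F _ W.a₄) / xGen W ^ 2)) (f : W.FunctionField) :
    k f = f ↔ f ∈ Set.range φ := by
  have : CharZero W.FunctionField := charZero_of_injective_algebraMap
    (algebraMap F W.FunctionField).injective
  exact fixed_iff_mem_range (φ : W'.FunctionField →+* W.FunctionField)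
    (k : W.FunctionField →+* W.FunctionField) (h.translation_comp kx ky hφx hφy)
    (h.translation_slope kx ky) (h.slope_sq_mem_range hφx)
    (h.subfield_eq_top_of_slope_mem hφy) f

theorem hom_genericPoint (h : IsogenyPair c W W')
    (hφx : φ (xGen W') = algebraMap F _ c ^ 2 * (yGen W ^ 2 / xGen W ^ 2))
    (hφy : φ (yGen W') = algebraMap F _ c ^ 3 *
      (yGen W * (xGen W ^ 2 - algebraMap F _ W.a₄) / xGen W ^ 2))
    [DecidableEq W.FunctionField] :
    (h.map (algebraMap F W.FunctionField)).hom (genericPoint W) =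
      mapPoint W' φ (genericPoint W') :=
  ((h.map (algebraMap F W.FunctionField)).hom_some _ (xGen_ne W)).trans
    (point_some_congr hφx.symm hφy.symm)

theorem hom_mapPoint (h : IsogenyPair c W W') {L M : Type*} [Field L] [Algebra F L] [Field M]
    [Algebra F M] [DecidableEq L] [DecidableEq M] (f : L →ₐ[F] M) (P : PointsOver W L) :
    (h.map (algebraMap F M)).hom (mapPoint W f P) =
      mapPoint W' f ((h.map (algebraMap F L)).hom P) := by
  rcases P with _ | ⟨x, y, hxy⟩
  · rfl
  rw [mapPoint_some]
  by_cases hx : x = 0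
  · subst hx
    have e₁ : (h.map (algebraMap F L)).hom (.some 0 y hxy) = 0 :=
      ((h.map (algebraMap F L)).hom_eq_zero_iff _).2
        (.inr (point_some_congr rfl ((h.map (algebraMap F L)).y_eq_zero hxy)))
    have e₂ : (h.map (algebraMap F M)).hom (.some (f 0) (f y)
        ((W.baseChange_nonsingular f.injective ..).mpr hxy)) = 0 :=
      ((h.map (algebraMap F M)).hom_eq_zero_iff _).2 (.inr (point_some_congr (map_zero f)
        (by rw [(h.map (algebraMap F L)).y_eq_zero hxy, map_zero])))
    exact e₂.trans (congrArg (mapPoint W' f) e₁).symm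
  · refine ((h.map (algebraMap F M)).hom_some _ ((map_ne_zero f).2 hx)).trans ?_
    refine Eq.trans ?_ (congrArg (mapPoint W' f) ((h.map (algebraMap F L)).hom_some hxy hx)).symm
    refine (point_some_congr ?_ ?_).trans (mapPoint_some _ _ _).symm
    · simp
    · simp

theorem isTwoIsogeny (h : IsogenyPair c W W')
    (hT : (WeierstrassCurve.Affine.baseChange W F).Nonsingular 0 0)
    (hφx : φ (xGen W') = algebraMap F _ c ^ 2 * (yGen W ^ 2 / xGen W ^ 2))
    (hφy : φ (yGen W') = algebraMap F _ c ^ 3 *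
      (yGen W * (xGen W ^ 2 - algebraMap F _ W.a₄) / xGen W ^ 2)) :
    IsTwoIsogeny W W' (.some 0 0 hT) φ := by
  classical
  have : CharZero W.FunctionField := charZero_of_injective_algebraMap
    (algebraMap F W.FunctionField).injective
  refine ⟨⟨fun L _ _ => (h.map (algebraMap F L)).hom, ?_, ?_, ?_⟩, ?_⟩
  · intro L M _ _ _ _ f P
    exact h.hom_mapPoint f P
  · exact h.hom_genericPoint hφx hφy
  · intro L _ _ P
    rw [mapPoint_some]
    refine ((h.map (algebraMap F L)).hom_eq_zero_iff P).trans ?_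
    exact or_congr Iff.rfl (iff_of_eq (congrArg (P = ·)
      (point_some_congr (map_zero _).symm (map_zero _).symm)))
  · obtain ⟨k, kx, ky⟩ := h.exists_translation
    exact finrank_fieldRange_eq_two φ (k : W.FunctionField →+* W.FunctionField)
      (h.translation_comp kx ky hφx hφy)
      (h.translation_slope kx ky) (div_ne_zero h.yGen_ne (xGen_ne W)) (h.slope_sq_mem_range hφx)
      (h.subfield_eq_top_of_slope_mem hφy)

/-- Naturality of the isogeny on points carries it through the field maps, so the claim becomes
`hom_hom` at the generic point. -/
theorem mapPoint_comp_eq_two_nsmul (h : IsogenyPair c W W') {c' : F} (h' : IsogenyPair c' W' W)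
    (hc : 2 * c * c' = 1) {φ' : W.FunctionField →ₐ[F] W'.FunctionField}
    (hφx : φ (xGen W') = algebraMap F _ c ^ 2 * (yGen W ^ 2 / xGen W ^ 2))
    (hφy : φ (yGen W') = algebraMap F _ c ^ 3 *
      (yGen W * (xGen W ^ 2 - algebraMap F _ W.a₄) / xGen W ^ 2))
    (hφx' : φ' (xGen W) = algebraMap F _ c' ^ 2 * (yGen W' ^ 2 / xGen W' ^ 2))
    (hφy' : φ' (yGen W) = algebraMap F _ c' ^ 3 *
      (yGen W' * (xGen W' ^ 2 - algebraMap F _ W'.a₄) / xGen W' ^ 2))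
    [DecidableEq W.FunctionField] :
    mapPoint W (φ.comp φ') (genericPoint W) = 2 • genericPoint W := by
  classical
  have e : mapPoint W (φ.comp φ') (genericPoint W) =
      mapPoint W φ (mapPoint W φ' (genericPoint W)) := rfl
  rw [e, ← h'.hom_genericPoint hφx' hφy', ← h'.hom_mapPoint, ← h.hom_genericPoint hφx hφy]
  exact (h.map (algebraMap F W.FunctionField)).hom_hom (h'.map _)
    (by rw [← map_ofNat (algebraMap F W.FunctionField), ← map_mul, ← map_mul, hc, map_one]) _

theorem areDual (h : IsogenyPair c W W') {c' : F} (h' : IsogenyPair c' W' W)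
    (hc : 2 * c * c' = 1) {φ' : W.FunctionField →ₐ[F] W'.FunctionField}
    (hφx : φ (xGen W') = algebraMap F _ c ^ 2 * (yGen W ^ 2 / xGen W ^ 2))
    (hφy : φ (yGen W') = algebraMap F _ c ^ 3 *
      (yGen W * (xGen W ^ 2 - algebraMap F _ W.a₄) / xGen W ^ 2))
    (hφx' : φ' (xGen W) = algebraMap F _ c' ^ 2 * (yGen W' ^ 2 / xGen W' ^ 2))
    (hφy' : φ' (yGen W) = algebraMap F _ c' ^ 3 *
      (yGen W' * (xGen W' ^ 2 - algebraMap F _ W'.a₄) / xGen W' ^ 2)) :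
    AreDual W W' φ φ' :=
  ⟨h.mapPoint_comp_eq_two_nsmul h' hc hφx hφy hφx' hφy',
    h'.mapPoint_comp_eq_two_nsmul h (by rw [← hc]; ring) hφx' hφy' hφx hφy⟩

/-- A preimage of `(X, Y)` with `X = c² s² ≠ 0` has `y = ± s x` with `x² + (a - s²) x + b = 0`, the
sign being dictated by `Y`. For `X = 0` the two-torsion points other than `(0, 0)` serve. The root
is nonzero because `b ≠ 0`. -/
theorem hom_surjective {K : Type*} [Field K] [IsAlgClosed K] [DecidableEq K] {c : K}
    {W W' : WeierstrassCurve.Affine K} (h : IsogenyPair c W W') : Function.Surjective h.hom := by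
  have c0 := h.c_ne
  have two0 : NeZero (2 : K) := ⟨h.two_ne⟩
  have hroot : ∀ t : K, ∃ x, x ≠ 0 ∧ x ^ 2 + t * x + W.a₄ = 0 := by
    intro t
    obtain ⟨s, hs⟩ := IsAlgClosed.exists_pow_nat_eq (discrim 1 t W.a₄) (n := 2) (by norm_num)
    obtain ⟨x, hx⟩ := exists_quadratic_eq_zero (one_ne_zero (α := K)) ⟨s, by rw [← hs, sq]⟩
    refine ⟨x, ?_, by linear_combination hx⟩
    rintro rfl
    exact h.a₄_ne (by linear_combination hx)
  rintro (_ | ⟨X, Y, hXY⟩)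
  · exact ⟨0, map_zero _⟩
  have q := (h.nonsingular_iff' _ _).1 hXY
  rw [h.a₂', h.a₄'] at q
  by_cases hX : X = 0
  · subst hX
    obtain rfl : Y = 0 := pow_eq_zero_iff two_ne_zero |>.1 (by rw [q]; ring)
    obtain ⟨x, hx, e⟩ := hroot W.a₂
    refine ⟨.some x 0 ((h.nonsingular_iff _ _).2 (by linear_combination -x * e)), ?_⟩
    rw [h.hom_some _ hx]
    exact point_some_congr (by simp) (by simp)
  · obtain ⟨s, hs⟩ := IsAlgClosed.exists_pow_nat_eq (X / c ^ 2) (n := 2) (by norm_num)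
    obtain rfl : X = c ^ 2 * s ^ 2 := by rw [hs]; field_simp
    obtain ⟨x, hx, e⟩ := hroot (W.a₂ - s ^ 2)
    have hb : W.a₄ = -x ^ 2 - (W.a₂ - s ^ 2) * x := by linear_combination e
    have hsq : (c ^ 3 * (s * x * (x ^ 2 - W.a₄) / x ^ 2)) ^ 2 = Y ^ 2 := by
      rw [q, hb]
      field_simp
      ring
    rcases sq_eq_sq_iff_eq_or_eq_neg.1 hsq with hY | hY
    · refine ⟨.some x (s * x) ((h.nonsingular_iff _ _).2 (by rw [hb]; ring)), ?_⟩
      rw [h.hom_some _ hx]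
      exact point_some_congr (by field_simp) hY
    · refine ⟨.some x (-(s * x)) ((h.nonsingular_iff _ _).2 (by rw [hb]; ring)), ?_⟩
      rw [h.hom_some _ hx]
      refine point_some_congr (by field_simp) ?_
      rw [← neg_eq_iff_eq_neg] at hY
      rw [← hY]
      ring

theorem hom_some_eq {K : Type*} [Field K] [DecidableEq K] {c : K}
    {W W' : WeierstrassCurve.Affine K} (h : IsogenyPair c W W') {x y X Y : K}
    (hxy : W.Nonsingular x y) (hx : x ≠ 0) (hX : c ^ 2 * (y ^ 2 / x ^ 2) = X)
    (hY : c ^ 3 * (y * (x ^ 2 - W.a₄) / x ^ 2) = Y) :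
    ∃ h₁, h.hom (.some x y hxy) = .some X Y h₁ := by
  subst hX hY
  exact ⟨_, h.hom_some hxy hx⟩

end IsogenyPair

/-- Complex two-isogenies with the scalings of the theorem. -/
theorem haveDualTwoIsogenies {E E' : WeierstrassCurve.Affine ℂ} (h : IsogenyPair (1 / 2) E E')
    (h' : IsogenyPair 1 E' E) : HaveDualTwoIsogenies E E' := by
  classical
  refine ⟨h.nonsingular_zero, h'.nonsingular_zero, h.hom, h'.hom, ?_, ?_, ?_, ?_, ?_, ?_,
    h.hom_eq_zero_iff, h'.hom_eq_zero_iff, h.hom_hom h' (by norm_num), h'.hom_hom h (by norm_num)⟩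
  · intro x y hxy hx
    exact h.add_zero_zero hxy hx
  · intro x y hxy hx
    exact h'.add_zero_zero hxy hx
  · intro x y hxy hx
    exact h.hom_some_eq hxy hx (by field_simp; ring) (by field_simp; ring)
  · intro x y hxy hx
    refine h'.hom_some_eq hxy hx (by ring) ?_
    rw [h.a₄']
    field_simp
    ring
  · exact h.hom_surjective
  · exact h'.hom_surjective

end GenericIsogeny

/-! ### Two-forms on elliptic surfaces -/

section TwoFormLemmas

variable {K : Type*} [Field K] [Algebra ℂ K]

open KaehlerDifferential in
-- Since `du ∧ du = 0`, only the `dx`-component of `df` matters.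
theorem wedgeD_eq_smul {u x f A B : K} (h : D ℂ K f = A • D ℂ K x + B • D ℂ K u) :
    wedgeD u f = A • wedgeD u x := by
  have e : ∀ v : Ω[K⁄ℂ], (![D ℂ K u, v] : Fin 2 → Ω[K⁄ℂ]) =
    Function.update ![D ℂ K u, 0] 1 v := by
    intro v
    ext i
    fin_cases i <;> rfl
  have h0 : exteriorPower.ιMulti K 2 ![D ℂ K u, D ℂ K u] = 0 :=
    (exteriorPower.ιMulti K 2).map_eq_zero_of_eq _ (i := 0) (j := 1) rfl (by decide)
  unfold wedgeD
  rw [h, e, AlternatingMap.map_update_add, AlternatingMap.map_update_smul,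
    AlternatingMap.map_update_smul, ← e, ← e, h0, smul_zero, add_zero]

open KaehlerDifferential in
theorem wedgeD_const_div {u x b β : K} (hx : x ≠ 0) (hb : D ℂ K b = β • D ℂ K u) :
    wedgeD u (b / x) = (-(b / x ^ 2)) • wedgeD u x := by
  refine wedgeD_eq_smul (B := β / x) ?_
  rw [Derivation.leibniz_div, hb]
  match_scalars <;> field_simp

open KaehlerDifferential in
theorem wedgeD_isogeny {u x a b α β : K} (κ : ℂ) (hx : x ≠ 0) (ha : D ℂ K a = α • D ℂ K u)
    (hb : D ℂ K b = β • D ℂ K u) :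
    wedgeD u (algebraMap ℂ K κ * (x + a + b / x)) =
      (algebraMap ℂ K κ * (1 - b / x ^ 2)) • wedgeD u x := by
  refine wedgeD_eq_smul (B := algebraMap ℂ K κ * (α + β / x)) ?_
  rw [Derivation.leibniz, Derivation.map_algebraMap, map_add, map_add, Derivation.leibniz_div,
    ha, hb]
  match_scalars <;> field_simp <;> ring

variable (W : WeierstrassCurve ℂ[X])

theorem exists_D_ofPoly (p : ℂ[X]) : ∃ β : FunField W, KaehlerDifferential.D ℂ (FunField W) (ofPoly W p) =
    β • KaehlerDifferential.D ℂ (FunField W) (ofPoly W X) := by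
  have e : ofPoly W p = aeval (ofPoly W X) p := by
    induction p using Polynomial.induction_on' with
    | add p q hp hq => rw [map_add, ← hp, ← hq]; simp [ofPoly]
    | monomial n a =>
      rw [aeval_monomial, ← C_mul_X_pow_eq_monomial]
      simp only [ofPoly, map_mul, map_pow]
      congr 1
  rw [e, Derivation.map_aeval]
  exact ⟨_, rfl⟩

variable {W}

theorem pullback_twoForm {W' : WeierstrassCurve ℂ[X]} (φ : FunField W' →ₐ[RatFunc ℂ] FunField W)
    {A κ : FunField W} (hA : wedgeD (ofPoly W X) (φ (xGen (genericFibre W'))) =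
      A • wedgeD (ofPoly W X) (xGen (genericFibre W)))
    (hκ : (φ (yGen (genericFibre W')))⁻¹ * A = κ * (yGen (genericFibre W))⁻¹) :
    pullback (φ.restrictScalars ℂ) (twoForm W') = κ • twoForm W := by
  have hX : φ (ofPoly W' X) = ofPoly W X := φ.commutes _
  unfold twoForm
  rw [pullback_smul_wedgeD]
  have hinv : φ ((yGen (genericFibre W'))⁻¹) = (φ (yGen (genericFibre W')))⁻¹ := map_inv₀ φ _
  simp only [AlgHom.restrictScalars_apply]
  rw [hX, hA, smul_smul, hinv, hκ, smul_smul]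

theorem pullback_smul_smul {K L : Type*} [Field K] [Field L] [Algebra ℂ K] [Algebra ℂ L]
    (φ : K →ₐ[ℂ] L) (κ a f g : K) :
    pullback φ (κ • a • wedgeD f g) = φ κ • pullback φ (a • wedgeD f g) := by
  rw [smul_smul, pullback_smul_wedgeD, pullback_smul_wedgeD, smul_smul, map_mul]

/-- Modulo `du`, `d(b / x) = -(b / x²) dx`, and `y` is multiplied by the same factor `-b / x²`. -/
theorem pullback_translation {c : RatFunc ℂ} {E : WeierstrassCurve.Affine (RatFunc ℂ)}
    (h : IsogenyPair c (genericFibre W) E) {k : FunField W ≃ₐ[RatFunc ℂ] FunField W}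
    (kx : k (xGen (genericFibre W)) = algebraMap (RatFunc ℂ) _ (genericFibre W).a₄ /
      xGen (genericFibre W))
    (ky : k (yGen (genericFibre W)) = -(algebraMap (RatFunc ℂ) _ (genericFibre W).a₄ *
      yGen (genericFibre W)) / xGen (genericFibre W) ^ 2) :
    pullback ((k : FunField W →ₐ[RatFunc ℂ] FunField W).restrictScalars ℂ) (twoForm W) =
      twoForm W := by
  have hx := xGen_ne (genericFibre W)
  have hy := h.yGen_ne
  have hb : algebraMap (RatFunc ℂ) (FunField W) (genericFibre W).a₄ ≠ 0 :=
    (_root_.map_ne_zero _).2 h.a₄_ne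
  obtain ⟨β, hβ⟩ := exists_D_ofPoly W W.a₄
  rw [pullback_twoForm (κ := 1) (k : FunField W →ₐ[RatFunc ℂ] FunField W)
    ((congrArg (wedgeD _) kx).trans (wedgeD_const_div hx hβ)), one_smul]
  refine (congrArg (fun z => z⁻¹ * _) ky).trans ?_
  change _ * -(algebraMap (RatFunc ℂ) (FunField W) (genericFibre W).a₄ / _) = _
  field_simp

/-- The numerator contributes `c² (1 - b / x²) dx` and the denominator `c³ y (1 - b / x²)`, whence
the factor `c⁻¹`. -/
theorem pullback_isogeny {W' : WeierstrassCurve ℂ[X]} {c : ℂ}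
    (h : IsogenyPair (algebraMap ℂ (RatFunc ℂ) c) (genericFibre W) (genericFibre W'))
    {φ : FunField W' →ₐ[RatFunc ℂ] FunField W}
    (hφx : φ (xGen (genericFibre W')) = algebraMap (RatFunc ℂ) _ (algebraMap ℂ (RatFunc ℂ) c) ^ 2 *
      (yGen (genericFibre W) ^ 2 / xGen (genericFibre W) ^ 2))
    (hφy : φ (yGen (genericFibre W')) = algebraMap (RatFunc ℂ) _ (algebraMap ℂ (RatFunc ℂ) c) ^ 3 *
      (yGen (genericFibre W) * (xGen (genericFibre W) ^ 2 -
        algebraMap (RatFunc ℂ) _ (genericFibre W).a₄) / xGen (genericFibre W) ^ 2)) :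
    pullback (φ.restrictScalars ℂ) (twoForm W') =
      (algebraMap ℂ (FunField W) c)⁻¹ • twoForm W := by
  have hx := xGen_ne (genericFibre W)
  have hy := h.yGen_ne
  have hc : algebraMap ℂ (FunField W) c ≠ 0 := by
    rw [_root_.map_ne_zero]
    exact fun h0 => h.c_ne (by rw [h0, map_zero])
  obtain ⟨α, hα⟩ := exists_D_ofPoly W W.a₂
  obtain ⟨β, hβ⟩ := exists_D_ofPoly W W.a₄
  rw [← IsScalarTower.algebraMap_apply] at hφx hφy
  have hφx' : φ (xGen (genericFibre W')) = algebraMap ℂ (FunField W) (c ^ 2) *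
      (xGen (genericFibre W) + ofPoly W W.a₂ + ofPoly W W.a₄ / xGen (genericFibre W)) := by
    rw [hφx, h.generic_equation, map_pow]
    change _ * ((_ + ofPoly W W.a₂ * _ + ofPoly W W.a₄ * _) / _) = _
    field_simp
  -- The common factor `1 - b / x²` must be nonzero to cancel; `x² = b` would make `x` algebraic
  -- over `ℂ(u)`.
  have hne : xGen (genericFibre W) ^ 2 - ofPoly W W.a₄ ≠ 0 := by
    intro h0
    refine transcendental_xGen (genericFibre W) ⟨X ^ 2 - C (genericFibre W).a₄, fun hp => ?_, ?_⟩
    · simpa using congrArg (coeff · 2) hp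
    · rw [map_sub, map_pow, aeval_X, aeval_C]
      exact h0
  refine pullback_twoForm φ ((congrArg (wedgeD _) hφx').trans (wedgeD_isogeny _ hx hα hβ)) ?_
  rw [hφy]
  change (_ * (_ * (_ - ofPoly W W.a₄) / _))⁻¹ * _ = _
  rw [map_pow]
  field_simp

end TwoFormLemmas

/-! ### The surfaces `𝒴` and `𝒮'` -/

section TheSurfaces

variable {l₁ l₂ : ℂ}

theorem surfaceS'_a₂_sq_sub (l₁ l₂ : ℂ) : (surfaceS' l₁ l₂).a₂ ^ 2 - 4 * (surfaceS' l₁ l₂).a₄ =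
    (surfaceY l₁ l₂).a₄ := by
  have e₁ : C (1 / 2 : ℂ) ^ 2 = 4 * C (1 / 16) := by
    rw [← C_pow, ← C_ofNat, ← C_mul]; norm_num
  have e₂ : 4 * C (1 / 16) * C (64 * l₁ * l₂) = C (16 * l₁ * l₂) := by
    rw [← C_ofNat, ← C_mul, ← C_mul]; congr 1; norm_num; ring
  simp only [surfaceS', surfaceY]
  linear_combination X ^ 2 * q l₁ l₂ ^ 2 * e₁ + X ^ 4 * e₂

theorem sixteen_mul_surfaceS'_a₄ (l₁ l₂ : ℂ) : 16 * (surfaceS' l₁ l₂).a₄ =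
    (surfaceY l₁ l₂).a₂ ^ 2 - 4 * (surfaceY l₁ l₂).a₄ := by
  have e₁ : 16 * C (1 / 16 : ℂ) = 1 := by
    rw [← C_ofNat, ← C_mul]; norm_num
  have e₂ : C (64 * l₁ * l₂) = 4 * C (16 * l₁ * l₂) := by
    rw [← C_ofNat, ← C_mul]; congr 1; ring
  simp only [surfaceS', surfaceY]
  linear_combination X ^ 2 * (q l₁ l₂ ^ 2 - C (64 * l₁ * l₂) * X ^ 2) * e₁ - X ^ 4 * e₂

theorem two_mul_surfaceS'_a₂ (l₁ l₂ : ℂ) :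
    2 * (surfaceS' l₁ l₂).a₂ = -(surfaceY l₁ l₂).a₂ := by
  have e₁ : 2 * C (1 / 2 : ℂ) = 1 := by
    rw [← C_ofNat, ← C_mul]; norm_num
  simp only [surfaceS', surfaceY]
  linear_combination -X * q l₁ l₂ * e₁

/-- The coefficient relations hold over `ℂ[u]`, so `g` can be the inclusion in `ℂ(u)` (generic
fibre) or the evaluation at a point (special fibre). -/
theorem isogenyPair_YS {K : Type*} [Field K] [CharZero K] (g : ℂ[X] →+* K)
    (hY : g (surfaceY l₁ l₂).a₄ ≠ 0) (hS : g (surfaceS' l₁ l₂).a₄ ≠ 0) :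
    IsogenyPair (1 / 2) ((surfaceY l₁ l₂).map g).toAffine ((surfaceS' l₁ l₂).map g).toAffine where
  a₁ := map_zero g
  a₃ := map_zero g
  a₆ := map_zero g
  a₁' := map_zero g
  a₃' := map_zero g
  a₆' := map_zero g
  a₂' := by
    have h := congrArg g (two_mul_surfaceS'_a₂ l₁ l₂)
    simp only [map_mul, map_neg, map_ofNat] at h
    simp only [WeierstrassCurve.map_a₂]
    linear_combination h / 2
  a₄' := by
    have h := congrArg g (sixteen_mul_surfaceS'_a₄ l₁ l₂)
    simp only [map_mul, map_sub, map_pow, map_ofNat] at h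
    simp only [WeierstrassCurve.map_a₂, WeierstrassCurve.map_a₄]
    linear_combination h / 16
  a₄_ne := hY
  a₄'_ne := hS
  two_ne := two_ne_zero

theorem isogenyPair_SY {K : Type*} [Field K] [CharZero K] (g : ℂ[X] →+* K)
    (hY : g (surfaceY l₁ l₂).a₄ ≠ 0) (hS : g (surfaceS' l₁ l₂).a₄ ≠ 0) :
    IsogenyPair 1 ((surfaceS' l₁ l₂).map g).toAffine ((surfaceY l₁ l₂).map g).toAffine where
  a₁ := map_zero g
  a₃ := map_zero g
  a₆ := map_zero g
  a₁' := map_zero g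
  a₃' := map_zero g
  a₆' := map_zero g
  a₂' := by
    have h := congrArg g (two_mul_surfaceS'_a₂ l₁ l₂)
    simp only [map_mul, map_neg, map_ofNat] at h
    simp only [WeierstrassCurve.map_a₂]
    linear_combination h
  a₄' := by
    have h := congrArg g (surfaceS'_a₂_sq_sub l₁ l₂)
    simp only [map_mul, map_sub, map_pow, map_ofNat] at h
    simp only [WeierstrassCurve.map_a₂, WeierstrassCurve.map_a₄]
    linear_combination -h
  a₄_ne := hS
  a₄'_ne := hY
  two_ne := two_ne_zero

theorem eval_q_zero (l₁ l₂ : ℂ) : (q l₁ l₂).eval 0 = (l₁ - 1) * (l₂ - 1) := by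
  simp [q]

theorem surfaceY_a₄_ne (h₁ : l₁ ≠ 0) (h₂ : l₂ ≠ 0) : (surfaceY l₁ l₂).a₄ ≠ 0 := by
  simp [surfaceY, h₁, h₂]

theorem surfaceS'_a₄_ne (h₁ : l₁ ≠ 1) (h₂ : l₂ ≠ 1) : (surfaceS' l₁ l₂).a₄ ≠ 0 := by
  have h : q l₁ l₂ ^ 2 - C (64 * l₁ * l₂) * X ^ 2 ≠ 0 := by
    intro h0
    have := congrArg (eval 0) h0
    simp [eval_q_zero, sub_eq_zero, h₁, h₂] at this
  simp only [surfaceS']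
  exact mul_ne_zero (mul_ne_zero (by norm_num) (pow_ne_zero 2 X_ne_zero)) h

theorem isogenyPair_generic_YS (h₁ : l₁ ≠ 0) (h₁' : l₁ ≠ 1) (h₂ : l₂ ≠ 0) (h₂' : l₂ ≠ 1) :
    IsogenyPair (1 / 2) (genericFibre (surfaceY l₁ l₂)) (genericFibre (surfaceS' l₁ l₂)) :=
  have : CharZero (RatFunc ℂ) := charZero_of_injective_algebraMap
    (algebraMap ℂ (RatFunc ℂ)).injective
  isogenyPair_YS (algebraMap ℂ[X] (RatFunc ℂ)) (by simpa using surfaceY_a₄_ne h₁ h₂)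
    (by simpa using surfaceS'_a₄_ne h₁' h₂')

theorem isogenyPair_generic_SY (h₁ : l₁ ≠ 0) (h₁' : l₁ ≠ 1) (h₂ : l₂ ≠ 0) (h₂' : l₂ ≠ 1) :
    IsogenyPair 1 (genericFibre (surfaceS' l₁ l₂)) (genericFibre (surfaceY l₁ l₂)) :=
  have : CharZero (RatFunc ℂ) := charZero_of_injective_algebraMap
    (algebraMap ℂ (RatFunc ℂ)).injective
  isogenyPair_SY (algebraMap ℂ[X] (RatFunc ℂ)) (by simpa using surfaceY_a₄_ne h₁ h₂)
    (by simpa using surfaceS'_a₄_ne h₁' h₂')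

/-- Up to constants the discriminants are `p₁² p₁'` here and `p₁'² p₁` for `𝒮'`, so the two surfaces
have smooth fibres over the same points. -/
theorem surfaceY_Δ (l₁ l₂ : ℂ) : (surfaceY l₁ l₂).Δ =
    2 ^ 8 * (surfaceY l₁ l₂).a₄ ^ 2 * (surfaceS' l₁ l₂).a₄ := by
  have h := sixteen_mul_surfaceS'_a₄ l₁ l₂
  have e₁ : (surfaceY l₁ l₂).a₁ = 0 := rfl
  have e₃ : (surfaceY l₁ l₂).a₃ = 0 := rfl
  have e₆ : (surfaceY l₁ l₂).a₆ = 0 := rfl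
  simp only [WeierstrassCurve.Δ, WeierstrassCurve.b₂, WeierstrassCurve.b₄, WeierstrassCurve.b₆,
    WeierstrassCurve.b₈, e₁, e₃, e₆]
  linear_combination -16 * (surfaceY l₁ l₂).a₄ ^ 2 * h

theorem surfaceS'_Δ (l₁ l₂ : ℂ) : (surfaceS' l₁ l₂).Δ =
    2 ^ 4 * (surfaceS' l₁ l₂).a₄ ^ 2 * (surfaceY l₁ l₂).a₄ := by
  have h := surfaceS'_a₂_sq_sub l₁ l₂
  have e₁ : (surfaceS' l₁ l₂).a₁ = 0 := rfl
  have e₃ : (surfaceS' l₁ l₂).a₃ = 0 := rfl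
  have e₆ : (surfaceS' l₁ l₂).a₆ = 0 := rfl
  simp only [WeierstrassCurve.Δ, WeierstrassCurve.b₂, WeierstrassCurve.b₄, WeierstrassCurve.b₆,
    WeierstrassCurve.b₈, e₁, e₃, e₆]
  linear_combination 16 * (surfaceS' l₁ l₂).a₄ ^ 2 * h

theorem fibre_surfaceY_Δ_ne_iff (u₀ : ℂ) : (fibre (surfaceY l₁ l₂) u₀).Δ ≠ 0 ↔
    (surfaceY l₁ l₂).a₄.eval u₀ ≠ 0 ∧ (surfaceS' l₁ l₂).a₄.eval u₀ ≠ 0 := by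
  rw [fibre, WeierstrassCurve.map_Δ, surfaceY_Δ]
  simp

theorem fibre_surfaceS'_Δ_ne_iff (u₀ : ℂ) : (fibre (surfaceS' l₁ l₂) u₀).Δ ≠ 0 ↔
    (surfaceY l₁ l₂).a₄.eval u₀ ≠ 0 ∧ (surfaceS' l₁ l₂).a₄.eval u₀ ≠ 0 := by
  rw [fibre, WeierstrassCurve.map_Δ, surfaceS'_Δ]
  simp [and_comm]

/-- The order at `u = 0` is exactly two, because `q` has value `(l₁ - 1) (l₂ - 1) ≠ 0` there. -/
theorem not_X_pow_dvd {κ γ : ℂ} (hκ : κ ≠ 0) (h₁ : l₁ ≠ 1) (h₂ : l₂ ≠ 1) :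
    ¬ X ^ 4 ∣ X ^ 2 * (C κ * q l₁ l₂ ^ 2 + C γ * X ^ 2) := by
  intro h
  have e : (X : ℂ[X]) ^ 4 = X ^ 2 * X ^ 2 := by ring
  rw [e, mul_dvd_mul_iff_left (pow_ne_zero 2 X_ne_zero)] at h
  obtain ⟨t, ht⟩ := h
  have := congrArg (eval 0) ht
  simp [eval_q_zero, sub_eq_zero, hκ, h₁, h₂] at this

/-- The coefficient of `u⁶` is `κ ((l₁ - 1) (l₂ - 1))² ≠ 0`. -/
theorem not_natDegree_le {κ γ : ℂ} (hκ : κ ≠ 0) (h₁ : l₁ ≠ 1) (h₂ : l₂ ≠ 1) :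
    ¬ (X ^ 2 * (C κ * q l₁ l₂ ^ 2 + C γ * X ^ 2)).natDegree ≤ 4 := by
  intro h
  have h6 := coeff_eq_zero_of_natDegree_lt (n := 6) (lt_of_le_of_lt h (by norm_num))
  set α := (l₁ - 1) * (l₂ - 1) with hα
  set β := 2 * (l₁ + 1) * (l₂ + 1) with hβ
  have e : X ^ 2 * (C κ * q l₁ l₂ ^ 2 + C γ * X ^ 2) = C (κ * α ^ 2) * X ^ 6 +
      C (-2 * κ * α * β) * X ^ 5 + C (κ * (2 * α ^ 2 + β ^ 2) + γ) * X ^ 4 +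
      C (-2 * κ * α * β) * X ^ 3 + C (κ * α ^ 2) * X ^ 2 := by
    simp only [q, ← hα, ← hβ, map_add, map_mul, map_pow, map_neg, C_ofNat]
    ring
  have h6' : κ * α ^ 2 = 0 := by
    rw [e] at h6
    simpa only [coeff_add, coeff_C_mul, coeff_X_pow, OfNat.ofNat_eq_ofNat, Nat.reduceEqDiff,
      if_true, if_false, mul_one, mul_zero, add_zero] using h6
  simp [hκ, hα, sub_eq_zero, h₁, h₂] at h6'

theorem isEllipticK3_of {W : WeierstrassCurve ℂ[X]} (a₁ : W.a₁ = 0) (a₃ : W.a₃ = 0)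
    (a₆ : W.a₆ = 0) (deg_a₂ : W.a₂.natDegree ≤ 4) (deg_a₄ : W.a₄.natDegree ≤ 8) (hΔ : W.Δ ≠ 0)
    {κ γ : ℂ} (hκ : κ ≠ 0) (h₁ : l₁ ≠ 1) (h₂ : l₂ ≠ 1)
    (hc₄ : W.c₄ = X ^ 2 * (C κ * q l₁ l₂ ^ 2 + C γ * X ^ 2))
    (hab : ∀ u₀ : ℂ, W.a₂.eval u₀ = 0 → W.a₄.eval u₀ = 0 → u₀ = 0) : IsEllipticK3 W where
  deg_a₁ := by simp [a₁]
  deg_a₂ := deg_a₂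
  deg_a₃ := by simp [a₃]
  deg_a₄ := deg_a₄
  deg_a₆ := by simp [a₆]
  disc_ne_zero := hΔ
  minimal := by
    rintro u₀ ⟨h4, h6⟩
    have e4 := eval_eq_zero_of_dvd_of_eval_eq_zero h4 (x := u₀) (by simp)
    have e6 := eval_eq_zero_of_dvd_of_eval_eq_zero h6 (x := u₀) (by simp)
    simp only [WeierstrassCurve.c₄, WeierstrassCurve.c₆, WeierstrassCurve.b₂,
      WeierstrassCurve.b₄, WeierstrassCurve.b₆, a₁, a₃, a₆] at e4 e6
    simp at e4 e6
    set a := W.a₂.eval u₀ with ha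
    set b := W.a₄.eval u₀ with hb
    -- Here `c₄ = 16 (a² - 3 b)` and `c₆ = -64 a³ + 288 a b`, so a common zero forces `a = b = 0`.
    -- This leaves only `u₀ = 0`, where `c₄` has order two.
    have e3 : a ^ 2 = 3 * b := by linear_combination e4 / 16
    have e5 : a * b = 0 := by linear_combination e6 / 96 + 2 / 3 * a * e3
    have ha0 : a = 0 := pow_eq_zero_iff three_ne_zero |>.1 (by linear_combination a * e3 + 3 * e5)
    have hb0 : b = 0 := by rw [ha0] at e3; linear_combination -e3 / 3
    obtain rfl := hab u₀ ha0 hb0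
    rw [map_zero, sub_zero, hc₄] at h4
    exact not_X_pow_dvd hκ h₁ h₂ h4
  minimal_infty := fun h => not_natDegree_le hκ h₁ h₂ (hc₄ ▸ h.1)

theorem natDegree_q_le (l₁ l₂ : ℂ) : (q l₁ l₂).natDegree ≤ 2 := by
  unfold q
  compute_degree

theorem isEllipticK3_surfaceY (h₁ : l₁ ≠ 0) (h₁' : l₁ ≠ 1) (h₂ : l₂ ≠ 0) (h₂' : l₂ ≠ 1) :
    IsEllipticK3 (surfaceY l₁ l₂) := by
  have hq := natDegree_q_le l₁ l₂
  -- From `c₄ = 16 (p₂² - 3 p₁)`.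
  refine isEllipticK3_of (κ := 16) (γ := -768 * l₁ * l₂) rfl rfl rfl ?_ ?_ ?_ (by norm_num)
    h₁' h₂' ?_ ?_
  · simp only [surfaceY]
    refine natDegree_mul_le.trans ?_
    rw [natDegree_X]
    omega
  · simp only [surfaceY]
    refine (natDegree_C_mul_X_pow_le _ _).trans (by norm_num)
  · rw [surfaceY_Δ]
    exact mul_ne_zero (mul_ne_zero (by norm_num) (pow_ne_zero 2 (surfaceY_a₄_ne h₁ h₂)))
      (surfaceS'_a₄_ne h₁' h₂')
  · simp only [WeierstrassCurve.c₄, WeierstrassCurve.b₂, WeierstrassCurve.b₄, surfaceY, map_mul,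
      map_neg, C_ofNat]
    ring
  · intro u₀ _ hb
    simpa [surfaceY, h₁, h₂] using hb

theorem isEllipticK3_surfaceS' (h₁ : l₁ ≠ 0) (h₁' : l₁ ≠ 1) (h₂ : l₂ ≠ 0) (h₂' : l₂ ≠ 1) :
    IsEllipticK3 (surfaceS' l₁ l₂) := by
  have hq := natDegree_q_le l₁ l₂
  -- From `c₄ = 16 (p₂'² - 3 p₁') = p₂² + 12 p₁`.
  refine isEllipticK3_of (κ := 1) (γ := 192 * l₁ * l₂) rfl rfl rfl ?_ ?_ ?_ one_ne_zero
    h₁' h₂' ?_ ?_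
  · simp only [surfaceS']
    refine natDegree_mul_le.trans ?_
    have : (-C (1 / 2 : ℂ) * X).natDegree ≤ 1 := by compute_degree
    omega
  · simp only [surfaceS']
    refine natDegree_mul_le.trans ?_
    have h1 : (C (1 / 16 : ℂ) * X ^ 2).natDegree ≤ 2 := by compute_degree
    have h2 : (q l₁ l₂ ^ 2 - C (64 * l₁ * l₂) * X ^ 2).natDegree ≤ 4 := by
      refine (natDegree_sub_le _ _).trans (max_le (natDegree_pow_le.trans (by omega)) ?_)
      exact (natDegree_C_mul_X_pow_le _ _).trans (by norm_num)
    omega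
  · rw [surfaceS'_Δ]
    exact mul_ne_zero (mul_ne_zero (by norm_num) (pow_ne_zero 2 (surfaceS'_a₄_ne h₁' h₂')))
      (surfaceY_a₄_ne h₁ h₂)
  · have e : (surfaceS' l₁ l₂).c₄ = 4 * (2 * (surfaceS' l₁ l₂).a₂) ^ 2 -
        3 * (16 * (surfaceS' l₁ l₂).a₄) := by
      have e₁ : (surfaceS' l₁ l₂).a₁ = 0 := rfl
      have e₃ : (surfaceS' l₁ l₂).a₃ = 0 := rfl
      simp only [WeierstrassCurve.c₄, WeierstrassCurve.b₂, WeierstrassCurve.b₄, e₁, e₃]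
      ring
    rw [e, two_mul_surfaceS'_a₂, sixteen_mul_surfaceS'_a₄]
    simp only [surfaceY, map_mul, C_ofNat, map_one]
    ring
  · intro u₀ ha hb
    have h := congrArg (eval u₀) (surfaceS'_a₂_sq_sub l₁ l₂)
    simp only [eval_sub, eval_pow, eval_mul, ha, hb] at h
    simpa [surfaceY, h₁, h₂] using h.symm

theorem isVanGeemenSarti {W : WeierstrassCurve ℂ[X]} {c : RatFunc ℂ}
    {E : WeierstrassCurve.Affine (RatFunc ℂ)} (h : IsogenyPair c (genericFibre W) E)
    (hW : IsEllipticK3 W)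
    (hT : (WeierstrassCurve.Affine.baseChange (genericFibre W) (RatFunc ℂ)).Nonsingular 0 0)
    {k : FunField W ≃ₐ[RatFunc ℂ] FunField W}
    (kx : k (xGen (genericFibre W)) = algebraMap (RatFunc ℂ) _ (genericFibre W).a₄ /
      xGen (genericFibre W))
    (ky : k (yGen (genericFibre W)) = -(algebraMap (RatFunc ℂ) _ (genericFibre W).a₄ *
      yGen (genericFibre W)) / xGen (genericFibre W) ^ 2) :
    IsVanGeemenSarti W (.some 0 0 hT) k where
  isEllipticK3 := hW
  order_two := by classical exact h.addOrderOf_zero_zero hT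
  translation := h.isTranslationBy hT kx ky
  involution := h.orderOf_translation kx ky
  symplectic := pullback_translation h kx ky

end TheSurfaces

/-! ### The Kummer surface -/

section KummerEquation

variable {K : Type*} [Field K]

/-- The coordinate `x` of `𝒮'` on `ℰ'₁ × ℰ'₂`, where `s₁ ^ 2 = l₁` and `s₂ ^ 2 = l₂`. -/
def kummerX (s₁ s₂ x₁ x₂ : K) : K :=
  x₁ / x₂ * ((1 - s₁) ^ 2 / 4 - x₁ / x₂ * ((1 - s₂) ^ 2 / 4)) *
    ((1 + s₁) ^ 2 / 4 - x₁ / x₂ * ((1 - s₂) ^ 2 / 4)) * (x₂ + (1 + s₂) ^ 2 / 4) /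
    (((1 - s₁ ^ 2) / (2 * (1 - s₂ ^ 2))) ^ 2 * (x₂ + (1 - s₂) ^ 2 / 4))

/-- The coordinate `y` of `𝒮'` on `ℰ'₁ × ℰ'₂`, in terms of `w = y₁ y₂`. -/
def kummerY (s₁ s₂ x₁ x₂ w : K) : K :=
  x₁ / x₂ * ((1 - s₁) ^ 2 / 4 - x₁ / x₂ * ((1 - s₂) ^ 2 / 4)) *
    ((1 + s₁) ^ 2 / 4 - x₁ / x₂ * ((1 - s₂) ^ 2 / 4)) * s₂ * w /
    (x₂ * ((1 - s₁ ^ 2) / (2 * (1 - s₂ ^ 2))) ^ 3 * (x₂ + (1 - s₂) ^ 2 / 4) ^ 2)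

/-- The elliptic parameter `u` of `𝒮'` on `ℰ'₁ × ℰ'₂`. -/
def kummerU (s₁ s₂ x₁ x₂ : K) : K := (1 - s₂ ^ 2) / (1 - s₁ ^ 2) * (x₁ / x₂)

/-- The value of the polynomial `q` at `u`. -/
def kummerQ (s₁ s₂ u : K) : K :=
  (s₁ ^ 2 - 1) * (s₂ ^ 2 - 1) * (u ^ 2 + 1) - 2 * (s₁ ^ 2 + 1) * (s₂ ^ 2 + 1) * u

theorem kummer_equation [CharZero K] {s₁ s₂ x₁ x₂ w : K} (h₁ : 1 - s₁ ^ 2 ≠ 0)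
    (h₂ : 1 - s₂ ^ 2 ≠ 0) (hx : x₂ ≠ 0) (hx' : x₂ + (1 - s₂) ^ 2 / 4 ≠ 0)
    (hw : w ^ 2 = (x₁ ^ 3 + (1 + s₁ ^ 2) / 2 * x₁ ^ 2 + (1 - s₁ ^ 2) ^ 2 / 16 * x₁) *
      (x₂ ^ 3 + (1 + s₂ ^ 2) / 2 * x₂ ^ 2 + (1 - s₂ ^ 2) ^ 2 / 16 * x₂)) :
    kummerY s₁ s₂ x₁ x₂ w ^ 2 = kummerX s₁ s₂ x₁ x₂ ^ 3 +
      -(1 / 2) * kummerU s₁ s₂ x₁ x₂ * kummerQ s₁ s₂ (kummerU s₁ s₂ x₁ x₂) *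
        kummerX s₁ s₂ x₁ x₂ ^ 2 +
      1 / 16 * kummerU s₁ s₂ x₁ x₂ ^ 2 * (kummerQ s₁ s₂ (kummerU s₁ s₂ x₁ x₂) ^ 2 -
        64 * s₁ ^ 2 * s₂ ^ 2 * kummerU s₁ s₂ x₁ x₂ ^ 2) * kummerX s₁ s₂ x₁ x₂ := by
  obtain ⟨t, rfl⟩ : ∃ t, x₁ = t * x₂ := ⟨x₁ / x₂, by field_simp⟩
  have ht : t * x₂ / x₂ = t := by field_simp
  set d := (1 - s₁ ^ 2) / (2 * (1 - s₂ ^ 2)) with hd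
  set α₁ := (1 - s₁) ^ 2 / 4 with hα₁
  set β₁ := (1 + s₁) ^ 2 / 4 with hβ₁
  set α₂ := (1 - s₂) ^ 2 / 4 with hα₂
  set β₂ := (1 + s₂) ^ 2 / 4 with hβ₂
  have hd0 : d ≠ 0 := div_ne_zero h₁ (mul_ne_zero two_ne_zero h₂)
  -- The nonzero roots of the cubic of `𝒮'`: the values of the Möbius function `P` at the remaining
  -- roots `-α₁ / t` and `-β₁ / t` of the quartic.
  set r₁ := -t * (β₁ - t * α₂) * (t * β₂ - α₁) / d ^ 2 with hr₁
  set r₂ := -t * (α₁ - t * α₂) * (t * β₂ - β₁) / d ^ 2 with hr₂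
  have hs : s₂ = β₂ - α₂ := by rw [hα₂, hβ₂]; field_simp; ring
  set U := kummerU s₁ s₂ (t * x₂) x₂ with hU
  have hU' : U = (1 - s₂ ^ 2) / (1 - s₁ ^ 2) * t := by rw [hU, kummerU, ht]
  have hA : -(1 / 2) * U * kummerQ s₁ s₂ U = -(r₁ + r₂) := by
    rw [hr₁, hr₂, hU', kummerQ, hd, hα₁, hα₂, hβ₁, hβ₂]
    field_simp
    ring
  have hB : 1 / 16 * U ^ 2 * (kummerQ s₁ s₂ U ^ 2 - 64 * s₁ ^ 2 * s₂ ^ 2 * U ^ 2) = r₁ * r₂ := by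
    rw [hr₁, hr₂, hU', kummerQ, hd, hα₁, hα₂, hβ₁, hβ₂]
    field_simp
    ring
  set P := kummerX s₁ s₂ (t * x₂) x₂ with hP
  have hP0 : P = t * (α₁ - t * α₂) * (β₁ - t * α₂) * (x₂ + β₂) / (d ^ 2 * (x₂ + α₂)) := by
    rw [hP, kummerX, ht]
  have hP1 : P - r₁ = t * (β₁ - t * α₂) * (β₂ - α₂) * (t * x₂ + α₁) / (d ^ 2 * (x₂ + α₂)) := by
    rw [hP0, hr₁]
    field_simp
    ring
  have hP2 : P - r₂ = t * (α₁ - t * α₂) * (β₂ - α₂) * (t * x₂ + β₁) / (d ^ 2 * (x₂ + α₂)) := by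
    rw [hP0, hr₂]
    field_simp
    ring
  have hY : kummerY s₁ s₂ (t * x₂) x₂ w = t * (α₁ - t * α₂) * (β₁ - t * α₂) * (β₂ - α₂) * w /
      (x₂ * d ^ 3 * (x₂ + α₂) ^ 2) := by
    rw [kummerY, ht, ← hs]
  have hw' : w ^ 2 = t * x₂ * (t * x₂ + α₁) * (t * x₂ + β₁) * (x₂ * (x₂ + α₂) * (x₂ + β₂)) := by
    rw [hw, hα₁, hβ₁, hα₂, hβ₂]
    field_simp
    ring
  have hfin : kummerY s₁ s₂ (t * x₂) x₂ w ^ 2 = P * (P - r₁) * (P - r₂) := by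
    rw [hP1, hP2, hP0, hY, div_pow, mul_pow, hw']
    field_simp
  rw [hfin, hA, hB]
  ring

end KummerEquation

/-! ### Recovering the invariants of the inversion from `u, x, y` -/

section KummerGenerators

variable {K : Type*} [Field K] [CharZero K]

/-- The parameter `u` gives `t = x₁ / x₂`. Over `ℂ(t)` the function `x` is a Möbius function of
`x₂`, invertible because `β₂ - α₂ = s₂ ≠ 0`. Finally `y` is a nonzero multiple of `w` by known
factors. -/
theorem mem_of_kummer_mem (R : Subfield K) {s₁ s₂ x₁ x₂ w : K} (hs₁ : s₁ ∈ R) (hs₂ : s₂ ∈ R)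
    (hU : kummerU s₁ s₂ x₁ x₂ ∈ R) (hX : kummerX s₁ s₂ x₁ x₂ ∈ R)
    (h₁ : 1 - s₁ ^ 2 ≠ 0) (h₂ : 1 - s₂ ^ 2 ≠ 0) (hs₂' : s₂ ≠ 0) (hx₁ : x₁ ≠ 0) (hx₂ : x₂ ≠ 0)
    (hx : x₂ + (1 - s₂) ^ 2 / 4 ≠ 0)
    (hα : (1 - s₁) ^ 2 / 4 - x₁ / x₂ * ((1 - s₂) ^ 2 / 4) ≠ 0)
    (hβ : (1 + s₁) ^ 2 / 4 - x₁ / x₂ * ((1 - s₂) ^ 2 / 4) ≠ 0) :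
    x₁ ∈ R ∧ x₂ ∈ R ∧ (kummerY s₁ s₂ x₁ x₂ w ∈ R → w ∈ R) := by
  have c₄ : (4 : K) ∈ R := ofNat_mem R 4
  have c₂ : (2 : K) ∈ R := ofNat_mem R 2
  have n₁ : 1 - s₁ ^ 2 ∈ R := sub_mem (one_mem R) (pow_mem hs₁ 2)
  have n₂ : 1 - s₂ ^ 2 ∈ R := sub_mem (one_mem R) (pow_mem hs₂ 2)
  have ht : x₁ / x₂ ∈ R := by
    have e : x₁ / x₂ = kummerU s₁ s₂ x₁ x₂ * (1 - s₁ ^ 2) / (1 - s₂ ^ 2) := by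
      rw [kummerU]
      field_simp
    rw [e]
    exact div_mem (mul_mem hU n₁) n₂
  have ht0 : x₁ / x₂ ≠ 0 := div_ne_zero hx₁ hx₂
  have hd : (1 - s₁ ^ 2) / (2 * (1 - s₂ ^ 2)) ∈ R := div_mem n₁ (mul_mem c₂ n₂)
  have hd0 : (1 - s₁ ^ 2) / (2 * (1 - s₂ ^ 2)) ≠ 0 := div_ne_zero h₁ (mul_ne_zero two_ne_zero h₂)
  have mα₁ : (1 - s₁) ^ 2 / 4 ∈ R := div_mem (pow_mem (sub_mem (one_mem R) hs₁) 2) c₄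
  have mα₂ : (1 - s₂) ^ 2 / 4 ∈ R := div_mem (pow_mem (sub_mem (one_mem R) hs₂) 2) c₄
  have mβ₁ : (1 + s₁) ^ 2 / 4 ∈ R := div_mem (pow_mem (add_mem (one_mem R) hs₁) 2) c₄
  have mβ₂ : (1 + s₂) ^ 2 / 4 ∈ R := div_mem (pow_mem (add_mem (one_mem R) hs₂) 2) c₄
  have hs : s₂ = (1 + s₂) ^ 2 / 4 - (1 - s₂) ^ 2 / 4 := by field_simp; ring
  rw [kummerX] at hX
  rw [kummerY]
  generalize (1 - s₁ ^ 2) / (2 * (1 - s₂ ^ 2)) = d at *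
  generalize (1 - s₁) ^ 2 / 4 = α₁ at *
  generalize (1 - s₂) ^ 2 / 4 = α₂ at *
  generalize (1 + s₁) ^ 2 / 4 = β₁ at *
  generalize (1 + s₂) ^ 2 / 4 = β₂ at *
  obtain ⟨t, rfl⟩ : ∃ t, x₁ = t * x₂ := ⟨x₁ / x₂, by field_simp⟩
  have e : t * x₂ / x₂ = t := by field_simp
  rw [e] at ht ht0 hα hβ hX ⊢
  have mα : α₁ - t * α₂ ∈ R := sub_mem mα₁ (mul_mem ht mα₂)
  have mβ : β₁ - t * α₂ ∈ R := sub_mem mβ₁ (mul_mem ht mα₂)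
  generalize α₁ - t * α₂ = A at *
  generalize β₁ - t * α₂ = B at *
  have hv : (x₂ + β₂) / (x₂ + α₂) ∈ R := by
    have e : (x₂ + β₂) / (x₂ + α₂) = t * A * B * (x₂ + β₂) /
        (d ^ 2 * (x₂ + α₂)) * d ^ 2 / (t * A * B) := by
      field_simp
    rw [e]
    exact div_mem (mul_mem hX (pow_mem hd 2)) (mul_mem (mul_mem ht mα) mβ)
  have hβα : β₂ - α₂ ≠ 0 := hs ▸ hs₂'
  have m₂ : x₂ ∈ R := by
    have e : x₂ = (β₂ - (x₂ + β₂) / (x₂ + α₂) * α₂) / ((x₂ + β₂) / (x₂ + α₂) - 1) := by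
      have e1 : (x₂ + β₂) / (x₂ + α₂) - 1 = (β₂ - α₂) / (x₂ + α₂) := by
        field_simp
        ring
      rw [e1]
      field_simp
      ring
    rw [e]
    exact div_mem (sub_mem mβ₂ (mul_mem hv mα₂)) (sub_mem hv (one_mem R))
  refine ⟨mul_mem ht m₂, m₂, fun hY => ?_⟩
  have e : w = t * A * B * s₂ * w / (x₂ * d ^ 3 * (x₂ + α₂) ^ 2) *
      (x₂ * d ^ 3 * (x₂ + α₂) ^ 2) / (t * A * B * s₂) := by
    field_simp
  rw [e]
  exact div_mem (mul_mem hY (mul_mem (mul_mem m₂ (pow_mem hd 3)) (pow_mem (add_mem m₂ mα₂) 2)))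
    (mul_mem (mul_mem (mul_mem ht mα) mβ) hs₂)

end KummerGenerators

/-! ### Transcendence degree and the inversion on the product -/

section ProductFields

open WeierstrassCurve.Affine

theorem not_isAlgebraic_ratFunc {L : Type} [Field L] [Algebra ℂ L] [Algebra (RatFunc ℂ) L]
    [IsScalarTower ℂ (RatFunc ℂ) L] (h : 2 ≤ Algebra.trdeg ℂ L) :
    ¬ Algebra.IsAlgebraic (RatFunc ℂ) L := by
  intro h0
  have h1 : Algebra.IsAlgebraic ℂ[X] (RatFunc ℂ) := IsLocalization.isAlgebraic _ (nonZeroDivisors _)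
  rw [← trdeg_add_eq ℂ (RatFunc ℂ) (A := L), trdeg_eq_zero_iff.2 h0, add_zero,
    ← trdeg_add_eq ℂ ℂ[X] (A := RatFunc ℂ), trdeg_eq_zero_iff.2 h1, add_zero,
    Polynomial.trdeg_of_isDomain] at h
  exact absurd h (by norm_num)

theorem exists_ratFunc_algHom {L : Type*} [Field L] [Algebra ℂ L] {u : L}
    (hu : Transcendental ℂ u) :
    ∃ g : RatFunc ℂ →ₐ[ℂ] L, ∀ p, g (algebraMap ℂ[X] _ p) = aeval u p := by
  have hi : Function.Injective (aeval (R := ℂ) u) := transcendental_iff_injective.1 hu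
  exact ⟨IsFractionRing.liftAlgHom (K := RatFunc ℂ) hi,
    fun p => IsFractionRing.lift_algebraMap hi p⟩

/-- The inversion on the function field, composed with an involution `ν` of the base field. -/
theorem exists_semilinear_negation {F : Type*} [Field F] [CharZero F] (W : WeierstrassCurve.Affine F)
    (a₁ : W.a₁ = 0) (a₃ : W.a₃ = 0) (ν : F →+* F) (hν : ∀ a, ν (ν a) = a) (hW : W.map ν = W) :
    ∃ i : W.FunctionField →+* W.FunctionField,
      (∀ a, i (algebraMap F _ a) = algebraMap F _ (ν a)) ∧ i (xGen W) = xGen W ∧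
      i (yGen W) = -yGen W ∧ ∀ z, i (i z) = z := by
  -- Semilinearity is encoded by twisting the coefficients with `ν`; since `ν` fixes the equation,
  -- `(x, -y)` is still a solution.
  let g : F →+* W.FunctionField := (algebraMap F W.FunctionField).comp ν
  have hg : W.map g = W.map (algebraMap F W.FunctionField) :=
    (WeierstrassCurve.map_map _ _ _).symm.trans
      (congrArg (fun V => WeierstrassCurve.map V (algebraMap F W.FunctionField)) hW)
  have heq : (W.map g).Equation (xGen W) (-yGen W) := by
    have e : -yGen W = (W.baseChange W.FunctionField).negY (xGen W) (yGen W) := by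
      simp [negY, a₁, a₃]
    rw [hg, e]
    exact (equation_neg _ _).2 (generic_nonsingular W).1
  obtain ⟨i, ig, ix, iy⟩ := exists_functionField_hom g heq (fun p hp => by
    have h := transcendental_iff.1 (transcendental_xGen W) (p.map ν)
      (by rw [aeval_def, eval₂_map]; exact hp)
    rwa [Polynomial.map_eq_zero] at h)
  have hi : i.comp i = RingHom.id _ := by
    refine functionField_hom_ext (fun a => ?_) ?_ ?_
    · simp only [RingHom.comp_apply, ig, g, RingHom.id_apply, hν]
    · simp [ix]
    · simp [iy]
  exact ⟨i, ig, ix, iy, fun z => congrArg (fun f : W.FunctionField →+* _ => f z) hi⟩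

/-- Built in two stages: negation on the first factor gives an involution `ν` of its function field,
and negation on the second factor is then extended `ν`-semilinearly. Its equation has complex
coefficients, which `ν` fixes. -/
theorem exists_isInversion (E₁ E₂ : WeierstrassCurve.Affine ℂ) (a₁ : E₁.a₁ = 0) (a₃ : E₁.a₃ = 0)
    (b₁ : E₂.a₁ = 0) (b₃ : E₂.a₃ = 0) :
    ∃ ι : ProductField E₁ E₂ ≃ₐ[ℂ] ProductField E₁ E₂, IsInversion E₁ E₂ ι := by
  have : CharZero E₁.FunctionField := charZero_of_injective_algebraMap
    (algebraMap ℂ E₁.FunctionField).injective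
  obtain ⟨ν, νC, νx, νy, νν⟩ := exists_semilinear_negation E₁ a₁ a₃ (RingHom.id ℂ) (fun _ => rfl)
    (WeierstrassCurve.map_id _)
  have hB : (WeierstrassCurve.Affine.baseChange E₂ E₁.FunctionField).map ν =
      WeierstrassCurve.Affine.baseChange E₂ E₁.FunctionField :=
    (WeierstrassCurve.map_map _ _ _).trans (congrArg (WeierstrassCurve.map E₂) (RingHom.ext νC))
  obtain ⟨i, iF, ix, iy, ii⟩ := exists_semilinear_negation
    (WeierstrassCurve.Affine.baseChange E₂ E₁.FunctionField) (by simp [b₁]) (by simp [b₃]) ν νν hB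
  have iC : ∀ a : ℂ, i (algebraMap ℂ (ProductField E₁ E₂) a) =
      algebraMap ℂ (ProductField E₁ E₂) a := by
    intro a
    rw [IsScalarTower.algebraMap_apply ℂ E₁.FunctionField (ProductField E₁ E₂)]
    exact (iF _).trans (congrArg _ (νC a))
  let ιh : ProductField E₁ E₂ →ₐ[ℂ] ProductField E₁ E₂ := { i with commutes' := iC }
  have hιh : ιh.comp ιh = AlgHom.id ℂ _ := AlgHom.ext ii
  refine ⟨AlgEquiv.ofAlgHom ιh ιh hιh hιh, ?_, ?_, ix, ?_⟩
  · exact (iF _).trans (congrArg _ νx)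
  · refine (iF _).trans (congrArg _ (νy.trans ?_))
    simp [negY, a₁, a₃]
  · refine iy.trans ?_
    simp [negY, b₁, b₃]

end ProductFields

/-! ### The function field of `𝒮'` as a fixed field -/

section KummerField

open WeierstrassCurve.Affine

theorem map_kummerU {K L : Type*} [Field K] [Field L] (f : K →+* L) (a b c d : K) :
    f (kummerU a b c d) = kummerU (f a) (f b) (f c) (f d) := by
  simp [kummerU]

theorem map_kummerX {K L : Type*} [Field K] [Field L] (f : K →+* L) (a b c d : K) :
    f (kummerX a b c d) = kummerX (f a) (f b) (f c) (f d) := by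
  simp [kummerX, map_ofNat]

theorem map_kummerY {K L : Type*} [Field K] [Field L] (f : K →+* L) (a b c d w : K) :
    f (kummerY a b c d w) = kummerY (f a) (f b) (f c) (f d) (f w) := by
  simp [kummerY, map_ofNat]

theorem transcendental_ne_algebraMap {L : Type*} [Field L] [Algebra ℂ L] {t : L}
    (ht : Transcendental ℂ t) (a : ℂ) : t ≠ algebraMap ℂ L a := by
  rintro rfl
  exact ht (isAlgebraic_algebraMap a)

theorem algebraMap_legendreQuotient_a₂ {L : Type*} [Field L] [Algebra ℂ L] (s : ℂ) :
    algebraMap ℂ L ((1 + s ^ 2) / 2) = (1 + algebraMap ℂ L s ^ 2) / 2 := by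
  simp only [map_div₀, map_pow, map_add, map_one, map_ofNat]

theorem algebraMap_legendreQuotient_a₄ {L : Type*} [Field L] [Algebra ℂ L] (s : ℂ) :
    algebraMap ℂ L ((1 - s ^ 2) ^ 2 / 16) = (1 - algebraMap ℂ L s ^ 2) ^ 2 / 16 := by
  simp only [map_div₀, map_pow, map_sub, map_one, map_ofNat]

theorem aeval_surfaceS'_a₂ {L : Type*} [Field L] [Algebra ℂ L] (s₁ s₂ : ℂ) (u : L) :
    aeval u (surfaceS' (s₁ ^ 2) (s₂ ^ 2)).a₂ =
      -(1 / 2) * u * kummerQ (algebraMap ℂ L s₁) (algebraMap ℂ L s₂) u := by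
  simp [surfaceS', q, kummerQ, map_ofNat]

theorem aeval_surfaceS'_a₄ {L : Type*} [Field L] [Algebra ℂ L] (s₁ s₂ : ℂ) (u : L) :
    aeval u (surfaceS' (s₁ ^ 2) (s₂ ^ 2)).a₄ =
      1 / 16 * u ^ 2 * (kummerQ (algebraMap ℂ L s₁) (algebraMap ℂ L s₂) u ^ 2 -
        64 * algebraMap ℂ L s₁ ^ 2 * algebraMap ℂ L s₂ ^ 2 * u ^ 2) := by
  simp [surfaceS', q, kummerQ, map_ofNat]

variable {L : Type} [Field L] [Algebra ℂ L] {s₁ s₂ : ℂ} {x₁ y₁ x₂ y₂ : L}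

theorem transcendental_kummerU (h₁ : s₁ ^ 2 ≠ 1) (h₂ : s₂ ^ 2 ≠ 1)
    (ht : Transcendental ℂ (x₁ / x₂)) :
    Transcendental ℂ (kummerU (algebraMap ℂ L s₁) (algebraMap ℂ L s₂) x₁ x₂) := by
  intro h
  have n₁ : algebraMap ℂ L (1 - s₁ ^ 2) ≠ 0 :=
    (_root_.map_ne_zero _).2 (sub_ne_zero.2 h₁.symm)
  have n₂ : algebraMap ℂ L (1 - s₂ ^ 2) ≠ 0 :=
    (_root_.map_ne_zero _).2 (sub_ne_zero.2 h₂.symm)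
  refine ht ?_
  have e : x₁ / x₂ = kummerU (algebraMap ℂ L s₁) (algebraMap ℂ L s₂) x₁ x₂ *
      algebraMap ℂ L ((1 - s₁ ^ 2) / (1 - s₂ ^ 2)) := by
    simp only [map_div₀]
    simp only [kummerU, map_sub, map_one, map_pow] at n₁ n₂ ⊢
    field_simp
  rw [e]
  exact h.mul (isAlgebraic_algebraMap _)

/-- The denominators and factors to be inverted are nonzero because `x₂` and `x₁ / x₂`, being
transcendental, never equal a complex constant. -/
theorem mem_of_kummerU_mem (h₁ : s₁ ^ 2 ≠ 1) (h₂ : s₂ ^ 2 ≠ 1) (h₂' : s₂ ≠ 0)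
    (hx₂ : Transcendental ℂ x₂) (ht : Transcendental ℂ (x₁ / x₂)) (R : Subfield L)
    (hC : ∀ a : ℂ, algebraMap ℂ L a ∈ R)
    (hU : kummerU (algebraMap ℂ L s₁) (algebraMap ℂ L s₂) x₁ x₂ ∈ R)
    (hX : kummerX (algebraMap ℂ L s₁) (algebraMap ℂ L s₂) x₁ x₂ ∈ R) (w : L) :
    x₁ ∈ R ∧ x₂ ∈ R ∧
      (kummerY (algebraMap ℂ L s₁) (algebraMap ℂ L s₂) x₁ x₂ w ∈ R → w ∈ R) := by
  have : CharZero L := charZero_of_injective_algebraMap (algebraMap ℂ L).injective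
  have n₁ : algebraMap ℂ L (1 - s₁ ^ 2) ≠ 0 :=
    (_root_.map_ne_zero _).2 (sub_ne_zero.2 h₁.symm)
  have n₂ : algebraMap ℂ L (1 - s₂ ^ 2) ≠ 0 :=
    (_root_.map_ne_zero _).2 (sub_ne_zero.2 h₂.symm)
  have n₃ : (1 - s₂) ^ 2 / 4 ≠ 0 := by
    refine div_ne_zero (pow_ne_zero 2 (sub_ne_zero.2 ?_)) (by norm_num)
    rintro rfl
    norm_num at h₂
  have x₂0 : x₂ ≠ 0 := by simpa using transcendental_ne_algebraMap hx₂ 0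
  have t0 : x₁ / x₂ ≠ 0 := by simpa using transcendental_ne_algebraMap ht 0
  have key : ∀ a : ℂ, algebraMap ℂ L a - x₁ / x₂ * ((1 - algebraMap ℂ L s₂) ^ 2 / 4) ≠ 0 := by
    intro a h
    refine transcendental_ne_algebraMap ht (a / ((1 - s₂) ^ 2 / 4)) ?_
    rw [map_div₀, eq_div_iff ((_root_.map_ne_zero _).2 n₃)]
    simp only [map_div₀, map_pow, map_sub, map_one, map_ofNat]
    linear_combination -h
  refine mem_of_kummer_mem R (hC s₁) (hC s₂) hU hX (by simpa using n₁) (by simpa using n₂)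
    ((_root_.map_ne_zero _).2 h₂') ?_ x₂0 ?_ ?_ ?_
  · rintro rfl
    simp at t0
  · intro h
    refine transcendental_ne_algebraMap hx₂ (-((1 - s₂) ^ 2 / 4)) ?_
    simp only [map_neg, map_div₀, map_pow, map_sub, map_one, map_ofNat]
    linear_combination h
  · have e : algebraMap ℂ L ((1 - s₁) ^ 2 / 4) = (1 - algebraMap ℂ L s₁) ^ 2 / 4 := by
      simp only [map_div₀, map_pow, map_sub, map_one, map_ofNat]
    exact e ▸ key _
  · have e : algebraMap ℂ L ((1 + s₁) ^ 2 / 4) = (1 + algebraMap ℂ L s₁) ^ 2 / 4 := by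
      simp only [map_div₀, map_pow, map_add, map_one, map_ofNat]
    exact e ▸ key _

/-- The function field of `𝒮'` is the fixed field of the inversion `ι` on a field `L` generated by
the coordinates `x₁, y₁, x₂, y₂` of the product of two elliptic curves. -/
theorem nonempty_algEquiv_equalizer (h₁ : s₁ ^ 2 ≠ 1) (h₂ : s₂ ^ 2 ≠ 1) (h₂' : s₂ ≠ 0)
    (hx₂ : Transcendental ℂ x₂) (ht : Transcendental ℂ (x₁ / x₂)) (hy₂ : y₂ ≠ 0)
    (htr : 2 ≤ Algebra.trdeg ℂ L)
    (htop : ∀ S : Subfield L, (∀ a : ℂ, algebraMap ℂ L a ∈ S) → x₁ ∈ S → y₁ ∈ S → x₂ ∈ S →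
      y₂ ∈ S → S = ⊤)
    (e₁ : y₁ ^ 2 = x₁ ^ 3 + algebraMap ℂ L ((1 + s₁ ^ 2) / 2) * x₁ ^ 2 +
      algebraMap ℂ L ((1 - s₁ ^ 2) ^ 2 / 16) * x₁)
    (e₂ : y₂ ^ 2 = x₂ ^ 3 + algebraMap ℂ L ((1 + s₂ ^ 2) / 2) * x₂ ^ 2 +
      algebraMap ℂ L ((1 - s₂ ^ 2) ^ 2 / 16) * x₂)
    (ι : L ≃ₐ[ℂ] L) (ιx₁ : ι x₁ = x₁) (ιy₁ : ι y₁ = -y₁) (ιx₂ : ι x₂ = x₂) (ιy₂ : ι y₂ = -y₂) :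
    Nonempty (FunField (surfaceS' (s₁ ^ 2) (s₂ ^ 2)) ≃ₐ[ℂ]
      AlgHom.equalizer (ι : L →ₐ[ℂ] L) (AlgHom.id ℂ L)) := by
  have : CharZero L := charZero_of_injective_algebraMap (algebraMap ℂ L).injective
  have n₁ : algebraMap ℂ L (1 - s₁ ^ 2) ≠ 0 :=
    (_root_.map_ne_zero _).2 (sub_ne_zero.2 h₁.symm)
  have n₂ : algebraMap ℂ L (1 - s₂ ^ 2) ≠ 0 :=
    (_root_.map_ne_zero _).2 (sub_ne_zero.2 h₂.symm)
  have x₂0 : x₂ ≠ 0 := by simpa using transcendental_ne_algebraMap hx₂ 0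
  have x₂α : x₂ + (1 - algebraMap ℂ L s₂) ^ 2 / 4 ≠ 0 := by
    intro h
    refine transcendental_ne_algebraMap hx₂ (-((1 - s₂) ^ 2 / 4)) ?_
    simp only [map_neg, map_div₀, map_pow, map_sub, map_one, map_ofNat]
    linear_combination h
  rw [algebraMap_legendreQuotient_a₂, algebraMap_legendreQuotient_a₄] at e₁ e₂
  obtain ⟨g, hg⟩ := exists_ratFunc_algHom (transcendental_kummerU (L := L) h₁ h₂ ht)
  set u := kummerU (algebraMap ℂ L s₁) (algebraMap ℂ L s₂) x₁ x₂ with hu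
  set x := kummerX (algebraMap ℂ L s₁) (algebraMap ℂ L s₂) x₁ x₂ with hx
  set y := kummerY (algebraMap ℂ L s₁) (algebraMap ℂ L s₂) x₁ x₂ (y₁ * y₂) with hy
  have hgC : ∀ a, g (algebraMap ℂ (RatFunc ℂ) a) = algebraMap ℂ L a := g.commutes
  have hgX : g (algebraMap ℂ[X] (RatFunc ℂ) X) = u := by rw [hg, aeval_X]
  have heq : ((genericFibre (surfaceS' (s₁ ^ 2) (s₂ ^ 2))).map (g : RatFunc ℂ →+* L)).Equation
      x y := by
    have ha₂ : ((genericFibre (surfaceS' (s₁ ^ 2) (s₂ ^ 2))).map (g : RatFunc ℂ →+* L)).a₂ =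
        aeval u (surfaceS' (s₁ ^ 2) (s₂ ^ 2)).a₂ := hg _
    have ha₄ : ((genericFibre (surfaceS' (s₁ ^ 2) (s₂ ^ 2))).map (g : RatFunc ℂ →+* L)).a₄ =
        aeval u (surfaceS' (s₁ ^ 2) (s₂ ^ 2)).a₄ := hg _
    have ha₁ : ((genericFibre (surfaceS' (s₁ ^ 2) (s₂ ^ 2))).map (g : RatFunc ℂ →+* L)).a₁ = 0 :=
      (hg 0).trans (map_zero _)
    have ha₃ : ((genericFibre (surfaceS' (s₁ ^ 2) (s₂ ^ 2))).map (g : RatFunc ℂ →+* L)).a₃ = 0 :=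
      (hg 0).trans (map_zero _)
    have ha₆ : ((genericFibre (surfaceS' (s₁ ^ 2) (s₂ ^ 2))).map (g : RatFunc ℂ →+* L)).a₆ = 0 :=
      (hg 0).trans (map_zero _)
    rw [equation_iff, ha₁, ha₂, ha₃, ha₄, ha₆, aeval_surfaceS'_a₂, aeval_surfaceS'_a₄]
    have := kummer_equation (s₁ := algebraMap ℂ L s₁)
      (s₂ := algebraMap ℂ L s₂) (x₁ := x₁) (x₂ := x₂) (w := y₁ * y₂) (by simpa using n₁) (by simpa using n₂) x₂0 x₂α
      (by rw [mul_pow, e₁, e₂])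
    rw [← hu, ← hx, ← hy] at this
    linear_combination this
  have htrans : ∀ p : (RatFunc ℂ)[X], p.eval₂ (g : RatFunc ℂ →+* L) x = 0 → p = 0 := by
    let : Algebra (RatFunc ℂ) L := (g : RatFunc ℂ →+* L).toAlgebra
    have : IsScalarTower ℂ (RatFunc ℂ) L := .of_algebraMap_eq' g.comp_algebraMap.symm
    suffices hT : Transcendental (RatFunc ℂ) x from transcendental_iff.1 hT
    -- If `x` were algebraic over `ℂ(u)`, the field of algebraic elements would contain `x₁, x₂`,
    -- then `y₁, y₂`, hence all of `L`, contradicting transcendence degree at least two.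
    refine fun hxa => not_isAlgebraic_ratFunc htr ⟨?_⟩
    let A : Subfield L := (algebraicClosure (RatFunc ℂ) L).toSubfield
    have hA : ∀ z, z ∈ A ↔ IsAlgebraic (RatFunc ℂ) z := fun z => mem_algebraicClosure_iff
    have hAg : ∀ a, g a ∈ A := fun a => (hA _).2 (isAlgebraic_algebraMap (A := L) a)
    have hAC : ∀ a : ℂ, algebraMap ℂ L a ∈ A := fun a => hgC a ▸ hAg _
    obtain ⟨mx₁, mx₂, -⟩ := mem_of_kummerU_mem h₁ h₂ h₂' hx₂ ht A hAC
      (by rw [← hu, ← hgX]; exact hAg _) ((hA _).2 hxa) 0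
    have hpoly : ∀ (s : ℂ) (z : L), z ∈ A → z ^ 3 + (1 + algebraMap ℂ L s ^ 2) / 2 * z ^ 2 +
        (1 - algebraMap ℂ L s ^ 2) ^ 2 / 16 * z ∈ A := by
      intro s z hz
      have c₁ : (1 + algebraMap ℂ L s ^ 2) / 2 ∈ A := by
        rw [← algebraMap_legendreQuotient_a₂]
        exact hAC _
      have c₂ : (1 - algebraMap ℂ L s ^ 2) ^ 2 / 16 ∈ A := by
        rw [← algebraMap_legendreQuotient_a₄]
        exact hAC _
      exact add_mem (add_mem (pow_mem hz 3) (mul_mem c₁ (pow_mem hz 2))) (mul_mem c₂ hz)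
    have my₁ : y₁ ∈ A := (hA _).2 (((hA _).1 (e₁ ▸ hpoly s₁ x₁ mx₁)).of_pow two_pos)
    have my₂ : y₂ ∈ A := (hA _).2 (((hA _).1 (e₂ ▸ hpoly s₂ x₂ mx₂)).of_pow two_pos)
    intro z
    exact (hA z).1 (htop A hAC mx₁ my₁ mx₂ my₂ ▸ Subfield.mem_top z)
  obtain ⟨Φ, ΦF, Φx, Φy⟩ := exists_functionField_hom (g : RatFunc ℂ →+* L) heq htrans
  have ιu : ι u = u := by
    refine (map_kummerU (ι : L →+* L) _ _ _ _).trans ?_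
    simp [ιx₁, ιx₂, hu]
  have ιg : ∀ a, ι (g a) = g a := by
    intro a
    obtain ⟨p, r, -, rfl⟩ := IsFractionRing.div_surjective (A := ℂ[X]) a
    have hp : ∀ p : ℂ[X], ι (aeval u p) = aeval u p := fun p => by
      rw [← aeval_algHom_apply, ιu]
    rw [map_div₀, map_div₀, hg, hg, hp, hp]
  have hΦ : ∀ a, (ι : L →+* L) (Φ a) = Φ a := by
    have : (ι : L →+* L).comp Φ = Φ := by
      refine functionField_hom_ext (fun a => ?_) ?_ ?_
      · simp [ΦF, ιg]
      · rw [RingHom.comp_apply, Φx, hx, map_kummerX]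
        simp [ιx₁, ιx₂]
      · rw [RingHom.comp_apply, Φy, hy, map_kummerY]
        simp [ιx₁, ιx₂, ιy₁, ιy₂]
    exact fun a => congrArg (fun f : _ →+* L => f a) this
  have ΦC : ∀ a : ℂ, Φ (algebraMap ℂ (FunField (surfaceS' (s₁ ^ 2) (s₂ ^ 2))) a) =
      algebraMap ℂ L a := by
    intro a
    rw [IsScalarTower.algebraMap_apply ℂ (RatFunc ℂ)]
    exact (ΦF _).trans (hgC a)
  have hR : x₁ ∈ Φ.fieldRange ∧ x₂ ∈ Φ.fieldRange ∧ y₁ * y₂ ∈ Φ.fieldRange := by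
    obtain ⟨m₁, m₂, hw⟩ := mem_of_kummerU_mem h₁ h₂ h₂' hx₂ ht Φ.fieldRange
      (fun a => ⟨_, ΦC a⟩) ⟨_, (ΦF _).trans hgX⟩ ⟨_, Φx⟩ (y₁ * y₂)
    exact ⟨m₁, m₂, hw ⟨_, Φy⟩⟩
  -- `L` is quadratic over the image of `Φ`, generated by `y₂`: its square is a cubic in `x₂`, `ι`
  -- negates it, and `y₁ = (y₁ y₂) / y₂`.
  have hfix := fixed_iff_mem_range Φ (ι : L →+* L) (s := y₂) hΦ ιy₂ (by
      rw [e₂]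
      have c₁ : (1 + algebraMap ℂ L s₂ ^ 2) / 2 ∈ Φ.fieldRange :=
        ⟨_, (ΦC _).trans (algebraMap_legendreQuotient_a₂ s₂)⟩
      have c₂ : (1 - algebraMap ℂ L s₂ ^ 2) ^ 2 / 16 ∈ Φ.fieldRange :=
        ⟨_, (ΦC _).trans (algebraMap_legendreQuotient_a₄ s₂)⟩
      exact add_mem (add_mem (pow_mem hR.2.1 3) (mul_mem c₁ (pow_mem hR.2.1 2)))
        (mul_mem c₂ hR.2.1)) (fun S hS hy => by
      have hle : ∀ z ∈ Φ.fieldRange, z ∈ S := by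
        rintro _ ⟨a, rfl⟩
        exact hS a
      refine htop S (fun a => ΦC a ▸ hS _) (hle _ hR.1) ?_ (hle _ hR.2.1) hy
      have := div_mem (hle _ hR.2.2) hy
      rwa [mul_div_cancel_right₀ _ hy₂] at this)
  let Φh : FunField (surfaceS' (s₁ ^ 2) (s₂ ^ 2)) →ₐ[ℂ] L := { Φ with commutes' := ΦC }
  refine ⟨AlgEquiv.ofBijective (Φh.codRestrict _ hΦ) ⟨?_, ?_⟩⟩
  · intro a b hab
    exact Φ.injective (congrArg Subtype.val hab)
  · rintro ⟨z, hz⟩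
    obtain ⟨a, ha⟩ := (hfix z).1 hz
    exact ⟨a, Subtype.ext ha⟩

/-- The dual isogeny back to the Legendre curve; it supplies the smoothness of `ℰ'` and its equation
at the generic point. -/
theorem isogenyPair_legendreQuotient {l : ℂ} (h₀ : l ≠ 0) (h₁ : l ≠ 1) :
    IsogenyPair 1 (legendreQuotient l) (legendre l) where
  a₁ := rfl
  a₃ := rfl
  a₆ := rfl
  a₁' := rfl
  a₃' := rfl
  a₆' := rfl
  a₂' := by simp only [legendre, legendreQuotient]; ring
  a₄' := by simp only [legendre, legendreQuotient]; ring
  a₄_ne := div_ne_zero (pow_ne_zero 2 (sub_ne_zero.2 h₁.symm)) (by norm_num)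
  a₄'_ne := h₀
  two_ne := two_ne_zero

end KummerField

/-! ### The tower `ℂ ⊂ ℂ(ℰ'₁) ⊂ ℂ(ℰ'₁ × ℰ'₂)` -/

section KummerOfProduct

open WeierstrassCurve.Affine

theorem map_equation {K L : Type*} [Field K] [Field L] (f : K →+* L) {x y a b : K}
    (h : y ^ 2 = x ^ 3 + a * x ^ 2 + b * x) :
    f y ^ 2 = f x ^ 3 + f a * f x ^ 2 + f b * f x := by
  simpa only [map_add, map_mul, map_pow] using congrArg f h

theorem transcendental_div_of_tower {K L : Type*} [Field K] [Field L] [Algebra ℂ K] [Algebra ℂ L]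
    [Algebra K L] [IsScalarTower ℂ K L] {z : L} (hz : Transcendental K z) {a : K} (ha : a ≠ 0) :
    Transcendental ℂ (algebraMap K L a / z) := by
  intro h
  have x0 := (_root_.map_ne_zero (algebraMap K L)).2 ha
  refine hz ?_
  have := (isAlgebraic_algebraMap (R := K) (A := L) a).mul (h.tower_top K).inv
  rwa [inv_div, mul_div_cancel₀ _ x0] at this

theorem nonempty_algEquiv_equalizer_of_tower {K L : Type} [Field K] [Field L] [Algebra ℂ K]
    [Algebra ℂ L] [Algebra K L] [IsScalarTower ℂ K L] {s₁ s₂ : ℂ}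
    (h₁ : s₁ ^ 2 ≠ 1) (h₂ : s₂ ^ 2 ≠ 1) (h₂' : s₂ ≠ 0) {ξ η : K} {x₂ y₂ : L} (hξ : ξ ≠ 0)
    (hK : Algebra.Transcendental ℂ K)
    (hξη : ∀ S : Subfield K, (∀ a : ℂ, algebraMap ℂ K a ∈ S) → ξ ∈ S → η ∈ S → S = ⊤)
    (e₁ : η ^ 2 = ξ ^ 3 + algebraMap ℂ K ((1 + s₁ ^ 2) / 2) * ξ ^ 2 +
      algebraMap ℂ K ((1 - s₁ ^ 2) ^ 2 / 16) * ξ)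
    (hx₂ : Transcendental K x₂) (hy₂ : y₂ ≠ 0)
    (htop : ∀ S : Subfield L, (∀ a, algebraMap K L a ∈ S) → x₂ ∈ S → y₂ ∈ S → S = ⊤)
    (e₂ : y₂ ^ 2 = x₂ ^ 3 + algebraMap K L (algebraMap ℂ K ((1 + s₂ ^ 2) / 2)) * x₂ ^ 2 +
      algebraMap K L (algebraMap ℂ K ((1 - s₂ ^ 2) ^ 2 / 16)) * x₂)
    (ι : L ≃ₐ[ℂ] L) (ιξ : ι (algebraMap K L ξ) = algebraMap K L ξ)
    (ιη : ι (algebraMap K L η) = -algebraMap K L η) (ιx₂ : ι x₂ = x₂) (ιy₂ : ι y₂ = -y₂) :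
    Nonempty (FunField (surfaceS' (s₁ ^ 2) (s₂ ^ 2)) ≃ₐ[ℂ]
      AlgHom.equalizer (ι : L →ₐ[ℂ] L) (AlgHom.id ℂ L)) := by
  have hL : Algebra.Transcendental K L := ⟨⟨_, hx₂⟩⟩
  refine nonempty_algEquiv_equalizer h₁ h₂ h₂' (fun h => hx₂ (h.tower_top K))
    (transcendental_div_of_tower hx₂ hξ) hy₂ ?_ ?_ ?_ ?_ ι ιξ ιη ιx₂ ιy₂
  · rw [← trdeg_add_eq ℂ K (A := L)]
    -- Each of the two layers of the tower is transcendental, so each contributes at least one.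
    calc (2 : Cardinal) = 1 + 1 := by norm_num
      _ ≤ _ := add_le_add (Cardinal.one_le_iff_pos.2 (trdeg_pos _ _))
        (Cardinal.one_le_iff_pos.2 (trdeg_pos _ _))
  · intro S hC hx hy hx₂ hy₂
    refine htop S (fun a => ?_) hx₂ hy₂
    have h : S.comap (algebraMap K L) = ⊤ := by
      refine hξη _ (fun a => ?_) hx hy
      rw [Subfield.mem_comap, ← IsScalarTower.algebraMap_apply]
      exact hC a
    have : a ∈ S.comap (algebraMap K L) := h ▸ Subfield.mem_top a
    exact this
  · rw [IsScalarTower.algebraMap_apply ℂ K L, IsScalarTower.algebraMap_apply ℂ K L]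
    exact map_equation _ e₁
  · rwa [IsScalarTower.algebraMap_apply ℂ K L, IsScalarTower.algebraMap_apply ℂ K L]

variable {s₁ s₂ : ℂ} {E₁ E₂ V₁ V₂ : WeierstrassCurve.Affine ℂ} {c₁ c₂ : ℂ}

theorem nonempty_algEquiv_equalizer_functionField {K : Type} [Field K] [CharZero K] [Algebra ℂ K]
    (hp₂ : IsogenyPair c₂ E₂ V₂) (h₁ : s₁ ^ 2 ≠ 1) (h₂ : s₂ ^ 2 ≠ 1) (h₂' : s₂ ≠ 0)
    (b₂ : E₂.a₂ = (1 + s₂ ^ 2) / 2) (b₄ : E₂.a₄ = (1 - s₂ ^ 2) ^ 2 / 16)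
    {ξ η : K} (hξ : ξ ≠ 0) (hK : Algebra.Transcendental ℂ K)
    (hξη : ∀ S : Subfield K, (∀ a : ℂ, algebraMap ℂ K a ∈ S) → ξ ∈ S → η ∈ S → S = ⊤)
    (e₁ : η ^ 2 = ξ ^ 3 + algebraMap ℂ K ((1 + s₁ ^ 2) / 2) * ξ ^ 2 +
      algebraMap ℂ K ((1 - s₁ ^ 2) ^ 2 / 16) * ξ)
    (ι : (WeierstrassCurve.Affine.baseChange E₂ K).FunctionField ≃ₐ[ℂ]
      (WeierstrassCurve.Affine.baseChange E₂ K).FunctionField)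
    (ιξ : ι (algebraMap K _ ξ) = algebraMap K _ ξ) (ιη : ι (algebraMap K _ η) = algebraMap K _ (-η))
    (ιx₂ : ι (xGen _) = xGen (WeierstrassCurve.Affine.baseChange E₂ K))
    (ιy₂ : ι (yGen _) = -yGen (WeierstrassCurve.Affine.baseChange E₂ K)) :
    Nonempty (FunField (surfaceS' (s₁ ^ 2) (s₂ ^ 2)) ≃ₐ[ℂ]
      AlgHom.equalizer (ι : (WeierstrassCurve.Affine.baseChange E₂ K).FunctionField →ₐ[ℂ]
        (WeierstrassCurve.Affine.baseChange E₂ K).FunctionField) (AlgHom.id ℂ _)) := by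
  have hp := hp₂.map (algebraMap ℂ K)
  refine nonempty_algEquiv_equalizer_of_tower h₁ h₂ h₂' hξ hK hξη e₁
    (transcendental_xGen (WeierstrassCurve.Affine.baseChange E₂ K)) hp.yGen_ne
    (fun S => subfield_eq_top S) ?_ ι ιξ (ιη.trans (map_neg _ _)) ιx₂ ιy₂
  rw [← b₂, ← b₄]
  exact hp.generic_equation

theorem IsInversion.nonempty_algEquiv
    (hp₁ : IsogenyPair c₁ E₁ V₁) (hp₂ : IsogenyPair c₂ E₂ V₂) (h₁ : s₁ ^ 2 ≠ 1) (h₂ : s₂ ^ 2 ≠ 1)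
    (h₂' : s₂ ≠ 0) (a₂ : E₁.a₂ = (1 + s₁ ^ 2) / 2) (a₄ : E₁.a₄ = (1 - s₁ ^ 2) ^ 2 / 16)
    (b₂ : E₂.a₂ = (1 + s₂ ^ 2) / 2) (b₄ : E₂.a₄ = (1 - s₂ ^ 2) ^ 2 / 16)
    {ι : ProductField E₁ E₂ ≃ₐ[ℂ] ProductField E₁ E₂} (hι : IsInversion E₁ E₂ ι) :
    Nonempty (FunField (surfaceS' (s₁ ^ 2) (s₂ ^ 2)) ≃ₐ[ℂ]
      AlgHom.equalizer (ι : ProductField E₁ E₂ →ₐ[ℂ] ProductField E₁ E₂) (AlgHom.id ℂ _)) := by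
  have : CharZero E₁.FunctionField := charZero_of_injective_algebraMap
    (algebraMap ℂ E₁.FunctionField).injective
  have e₁ := hp₁.generic_equation
  rw [a₂, a₄] at e₁
  refine nonempty_algEquiv_equalizer_functionField hp₂ h₁ h₂ h₂' b₂ b₄ (xGen_ne E₁)
    ⟨⟨_, transcendental_xGen E₁⟩⟩ (fun S => subfield_eq_top S) e₁ ι hι.x₁ ?_ hι.x₂ ?_
  · refine hι.y₁.trans (congrArg _ ?_)
    simp [negY, hp₁.a₁, hp₁.a₃]
  · refine hι.y₂.trans ?_
    simp [negY, hp₂.a₁, hp₂.a₃]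

theorem isKummerField {l₁ l₂ : ℂ} (h₁ : l₁ ≠ 0) (h₁' : l₁ ≠ 1) (h₂ : l₂ ≠ 0) (h₂' : l₂ ≠ 1) :
    IsKummerField (FunField (surfaceS' l₁ l₂)) (legendreQuotient l₁) (legendreQuotient l₂) := by
  have hp₁ := isogenyPair_legendreQuotient h₁ h₁'
  have hp₂ := isogenyPair_legendreQuotient h₂ h₂'
  obtain ⟨ι, hι⟩ := exists_isInversion (legendreQuotient l₁) (legendreQuotient l₂) rfl rfl rfl rfl
  refine ⟨hp₁.Δ_ne, hp₂.Δ_ne, ι, hι, ?_⟩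
  -- Square roots of the `λₙ` make the full two-torsion of `ℰ'ₙ` visible.
  obtain ⟨s₁, rfl⟩ := IsAlgClosed.exists_pow_nat_eq l₁ (n := 2) two_pos
  obtain ⟨s₂, rfl⟩ := IsAlgClosed.exists_pow_nat_eq l₂ (n := 2) two_pos
  exact hι.nonempty_algEquiv hp₁ hp₂ h₁' h₂' (fun h => h₂ (by simp [h])) rfl rfl rfl rfl

end KummerOfProduct

/-! ### The Legendre isogenies and the normalisation of constants -/

section Main

theorem isogenyPair_legendre {l : ℂ} (h₀ : l ≠ 0) (h₁ : l ≠ 1) :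
    IsogenyPair (1 / 2) (legendre l) (legendreQuotient l) where
  a₁ := rfl
  a₃ := rfl
  a₆ := rfl
  a₁' := rfl
  a₃' := rfl
  a₆' := rfl
  a₂' := by simp only [legendre, legendreQuotient]; ring
  a₄' := by simp only [legendre, legendreQuotient]; ring
  a₄_ne := h₀
  a₄'_ne := div_ne_zero (pow_ne_zero 2 (sub_ne_zero.2 h₁.symm)) (by norm_num)
  two_ne := two_ne_zero

theorem exists_isTwoIsogeny_legendre {l : ℂ} (h₀ : l ≠ 0) (h₁ : l ≠ 1) :
    ∃ hp ψ, IsTwoIsogeny (legendre l) (legendreQuotient l) (.some 0 0 hp) ψ := by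
  have h := isogenyPair_legendre h₀ h₁
  obtain ⟨φ, hx, hy⟩ := h.exists_hom
  exact ⟨(h.map (algebraMap ℂ ℂ)).nonsingular_zero, φ, h.isTwoIsogeny _ hx hy⟩

theorem half_sq_mul {K L : Type*} [Field K] [Field L] [CharZero L] [Algebra K L] (x y : L) :
    algebraMap K L (1 / 2) ^ 2 * (y ^ 2 / x ^ 2) = y ^ 2 / (4 * x ^ 2) := by
  rw [map_div₀, map_one, map_ofNat]
  by_cases hx : x = 0
  · simp [hx]
  · field_simp; ring

theorem half_cube_mul {K L : Type*} [Field K] [Field L] [CharZero L] [Algebra K L] (x z : L) :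
    algebraMap K L (1 / 2) ^ 3 * (z / x ^ 2) = z / (8 * x ^ 2) := by
  rw [map_div₀, map_one, map_ofNat]
  by_cases hx : x = 0
  · simp [hx]
  · field_simp; ring

theorem one_inv_eq_two_mul {L : Type*} [Field L] [CharZero L] : (1 : L)⁻¹ = 2 * 2⁻¹ := by
  norm_num

end Main

end KummerSandwich

open KummerSandwich in
theorem mainTheorem5 (l₁ l₂ : ℂ) (h₁ : l₁ ≠ 0) (h₁' : l₁ ≠ 1) (h₂ : l₂ ≠ 0) (h₂' : l₂ ≠ 1) :
    -- `𝒮'` is the Kummer surface of the product of the two-isogenous elliptic curves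
    IsKummerField (FunField (surfaceS' l₁ l₂)) (legendreQuotient l₁) (legendreQuotient l₂) ∧
    (∀ l ∈ ({l₁, l₂} : Set ℂ), ∃ hp ψ,
      IsTwoIsogeny (legendre l) (legendreQuotient l) (.some 0 0 hp) ψ) ∧
    ∃ (hT : (WeierstrassCurve.Affine.baseChange (genericFibre (surfaceY l₁ l₂))
        (RatFunc ℂ)).Nonsingular 0 0)
      (hT' : (WeierstrassCurve.Affine.baseChange (genericFibre (surfaceS' l₁ l₂))
        (RatFunc ℂ)).Nonsingular 0 0)
      (k : FunField (surfaceY l₁ l₂) ≃ₐ[RatFunc ℂ] FunField (surfaceY l₁ l₂))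
      (k' : FunField (surfaceS' l₁ l₂) ≃ₐ[RatFunc ℂ] FunField (surfaceS' l₁ l₂))
      (φ : FunField (surfaceS' l₁ l₂) →ₐ[RatFunc ℂ] FunField (surfaceY l₁ l₂))
      (φ' : FunField (surfaceY l₁ l₂) →ₐ[RatFunc ℂ] FunField (surfaceS' l₁ l₂)),
      -- the Van Geemen-Sarti involutions of the K3 surfaces `𝒴` and `𝒮'`
      IsVanGeemenSarti (surfaceY l₁ l₂) (.some 0 0 hT) k ∧
      IsVanGeemenSarti (surfaceS' l₁ l₂) (.some 0 0 hT') k' ∧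
      -- the dual two-isogenies; they are the quotient maps by the two involutions
      IsTwoIsogeny (genericFibre (surfaceY l₁ l₂)) (genericFibre (surfaceS' l₁ l₂))
        (.some 0 0 hT) φ ∧
      IsTwoIsogeny (genericFibre (surfaceS' l₁ l₂)) (genericFibre (surfaceY l₁ l₂))
        (.some 0 0 hT') φ' ∧
      AreDual (genericFibre (surfaceY l₁ l₂)) (genericFibre (surfaceS' l₁ l₂)) φ φ' ∧
      (∀ f, k f = f ↔ f ∈ Set.range φ) ∧
      (∀ f, k' f = f ↔ f ∈ Set.range φ') ∧
      -- the explicit formulas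
      (let X := xGen (genericFibre (surfaceY l₁ l₂))
       let Y := yGen (genericFibre (surfaceY l₁ l₂))
       let p₁ := ofPoly (surfaceY l₁ l₂) (surfaceY l₁ l₂).a₄
       k X = p₁ / X ∧ k Y = -(p₁ * Y) / X ^ 2 ∧
       φ (xGen _) = Y ^ 2 / (4 * X ^ 2) ∧
       φ (yGen _) = Y * (X ^ 2 - p₁) / (8 * X ^ 2)) ∧
      (let x := xGen (genericFibre (surfaceS' l₁ l₂))
       let y := yGen (genericFibre (surfaceS' l₁ l₂))
       let p₁ := ofPoly (surfaceS' l₁ l₂) (surfaceY l₁ l₂).a₄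
       let p₂ := ofPoly (surfaceS' l₁ l₂) (surfaceY l₁ l₂).a₂
       let p₁' := ofPoly (surfaceS' l₁ l₂) (surfaceS' l₁ l₂).a₄
       k' x = p₁' / x ∧ k' y = -(p₁' * y) / x ^ 2 ∧
       φ' (xGen _) = y ^ 2 / x ^ 2 ∧
       φ' (yGen _) = y * (16 * x ^ 2 - p₂ ^ 2 + 4 * p₁) / (16 * x ^ 2)) ∧
      -- the same formulas on every smooth fibre
      (∀ u₀ : ℂ, (fibre (surfaceY l₁ l₂) u₀).Δ ≠ 0 ↔ (fibre (surfaceS' l₁ l₂) u₀).Δ ≠ 0) ∧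
      (∀ u₀ : ℂ, (fibre (surfaceY l₁ l₂) u₀).Δ ≠ 0 →
        HaveDualTwoIsogenies (fibre (surfaceY l₁ l₂) u₀) (fibre (surfaceS' l₁ l₂) u₀)) ∧
      -- the two-forms
      pullback (φ.restrictScalars ℂ) (omegaS' l₁ l₂) = omegaY l₁ l₂ ∧
      pullback (φ'.restrictScalars ℂ) (omegaY l₁ l₂) = 2 • omegaS' l₁ l₂ := by
  have : CharZero (FunField (surfaceY l₁ l₂)) := charZero_of_injective_algebraMap
    (algebraMap ℂ (FunField (surfaceY l₁ l₂))).injective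
  have hYS := isogenyPair_generic_YS h₁ h₁' h₂ h₂'
  have hSY := isogenyPair_generic_SY h₁ h₁' h₂ h₂'
  obtain ⟨k, kx, ky⟩ := hYS.exists_translation
  obtain ⟨k', kx', ky'⟩ := hSY.exists_translation
  obtain ⟨φ, φx, φy⟩ := hYS.exists_hom
  obtain ⟨φ', φx', φy'⟩ := hSY.exists_hom
  -- The scalings are rewritten as complex constants, the form in which `pullback_isogeny` takes
  -- them.
  have e₂ : (1 / 2 : RatFunc ℂ) = algebraMap ℂ (RatFunc ℂ) (1 / 2) := by
    rw [map_div₀, map_one, map_ofNat]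
  have e₁ : (1 : RatFunc ℂ) = algebraMap ℂ (RatFunc ℂ) 1 := (map_one _).symm
  refine ⟨isKummerField h₁ h₁' h₂ h₂', ?_, (hYS.map (algebraMap _ _)).nonsingular_zero,
    (hSY.map (algebraMap _ _)).nonsingular_zero, k, k', φ, φ',
    isVanGeemenSarti hYS (isEllipticK3_surfaceY h₁ h₁' h₂ h₂') _ kx ky,
    isVanGeemenSarti hSY (isEllipticK3_surfaceS' h₁ h₁' h₂ h₂') _ kx' ky',
    hYS.isTwoIsogeny _ φx φy, hSY.isTwoIsogeny _ φx' φy',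
    hYS.areDual hSY (by norm_num) φx φy φx' φy',
    hYS.translation_fixed_iff kx ky φx φy, hSY.translation_fixed_iff kx' ky' φx' φy',
    ⟨kx, ky, φx.trans (half_sq_mul _ _), φy.trans (half_cube_mul _ _)⟩,
    ⟨kx', ky', ?_, ?_⟩, ?_, ?_, ?_, ?_⟩
  · rintro l (rfl | rfl)
    · exact exists_isTwoIsogeny_legendre h₁ h₁'
    · exact exists_isTwoIsogeny_legendre h₂ h₂'
  · exact φx'.trans (by rw [map_one, one_pow, one_mul])
  · refine φy'.trans ?_
    -- The relation `16 p₁' = p₂² - 4 p₁` turns `y (x² - p₁') / x²` into the stated ordinate.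
    have h := congrArg (ofPoly (surfaceS' l₁ l₂)) (sixteen_mul_surfaceS'_a₄ l₁ l₂)
    have h' : 16 * ofPoly (surfaceS' l₁ l₂) (surfaceS' l₁ l₂).a₄ =
        ofPoly (surfaceS' l₁ l₂) (surfaceY l₁ l₂).a₂ ^ 2 -
          4 * ofPoly (surfaceS' l₁ l₂) (surfaceY l₁ l₂).a₄ := by
      simpa only [ofPoly, map_mul, map_sub, map_pow, map_ofNat] using h
    have : CharZero (FunField (surfaceS' l₁ l₂)) := charZero_of_injective_algebraMap
      (algebraMap ℂ (FunField (surfaceS' l₁ l₂))).injective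
    have hx := xGen_ne (genericFibre (surfaceS' l₁ l₂))
    rw [map_one, one_pow, one_mul]
    change _ * (_ - ofPoly (surfaceS' l₁ l₂) (surfaceS' l₁ l₂).a₄) / _ = _
    field_simp
    linear_combination -yGen (genericFibre (surfaceS' l₁ l₂)) * h'
  · intro u₀
    rw [fibre_surfaceY_Δ_ne_iff, fibre_surfaceS'_Δ_ne_iff]
  · intro u₀ hu
    obtain ⟨hY, hS⟩ := (fibre_surfaceY_Δ_ne_iff u₀).1 hu
    exact haveDualTwoIsogenies (isogenyPair_YS (evalRingHom u₀) hY hS)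
      (isogenyPair_SY (evalRingHom u₀) hY hS)
  -- The factor `c⁻¹ = 2` for `c = 1/2` cancels the `1/2` in the definition of `omegaS'`.
  · rw [e₂] at hYS φx φy
    refine (pullback_smul_smul _ _ _ _ _).trans ?_
    refine (congrArg _ (pullback_isogeny hYS φx φy)).trans ?_
    rw [smul_smul]
    refine Eq.trans ?_ (one_smul (FunField (surfaceY l₁ l₂)) _)
    congr 1
    have h2 : φ (2 : FunField (surfaceS' l₁ l₂))⁻¹ = 2⁻¹ :=
      (map_inv₀ φ _).trans (congrArg _ (map_ofNat φ 2))
    refine (congrArg (· * _) h2).trans ?_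
    rw [map_div₀, map_one, map_ofNat]
    norm_num
  · rw [e₁] at hSY φx' φy'
    refine (pullback_isogeny hSY φx' φy').trans ?_
    unfold omegaS'
    have : CharZero (FunField (surfaceS' l₁ l₂)) := charZero_of_injective_algebraMap
      (algebraMap ℂ (FunField (surfaceS' l₁ l₂))).injective
    rw [← Nat.cast_smul_eq_nsmul (FunField (surfaceS' l₁ l₂)), smul_smul]
    congr 1
    rw [map_one, Nat.cast_ofNat]
    exact one_inv_eq_two_mul (L := FunField (surfaceS' l₁ l₂))
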